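/- Let $x$ be an $n$-dimensional real, wide-sense stationary, mean-square continuous process with both a forward Markovian representation $dx = Fx\,dt + G\,dw$, where all eigenvalues of $F$ have negative real part, and a backward Markovian representation $dx = \bar F x\,dt + \bar G\,d\bar w$, where all eigenvalues of $\bar F$ have positive real part. Here $F,\bar F\in\mathbb R^{n\times n}$, $G,\bar G\in\mathbb R^{n\times r}$, the matrix $G$ has full column rank, and $w,\bar w$ are normalized $r$-dimensional (wide-sense; in particular, Gaussian) Wiener processes on $\mathbb R$. Denote by $d\hat w$, $d\hat{\bar w}$ their Fourier transforms, i.e. the orthogonal stochastic measures on the imaginary axis with $$ w(t)-w(s)=\int_{-\infty}^{\infty}\frac{e^{j\lambda t}-e^{j\lambda s}}{j\lambda}\,d\hat w(j\lambda),\qquad \mathbb E\, d\hat w\, d\hat w^{*}=I\,\frac{d\lambda}{2\pi}, $$ and likewise for $\bar w$. Then there is a real rational $r\times r$ matrix function $K(s)$ which is inner (analytic in the closed right half plane, contractive for $\operatorname{Re}s>0$, and unitary on the imaginary axis) and is the scattering function of the pair, i.e. $$ d\hat{\bar w}(j\lambda)=K(j\lambda)\,d\hat w(j\lambda), $$ a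 relation that determines $K(j\lambda)$ for almost every $\lambda$, and which has the following property. Let $\eta$ be any $r$-dimensional process with stationary increments given by a linear function of the state and of the forward noise, and also by a linear function of the same state and of the backward noise, $$ d\eta = Cx\,dt + D\,dw = \bar C x\,dt+\bar D\,d\bar w, $$ with real constant matrices $C,\bar C, D,\bar D$, and let $$ T(s)=C(sI-F)^{-1}G+D,\qquad \bar T(s)=\bar C(sI-\bar F)^{-1}\bar G+\bar D $$ be the two transfer functions. If $T$ is invertible as a rational matrix function, then so is $\bar T$; moreover $\det\bar T(j\lambda)\neq 0$ for all but finitely many real $\lambda$, for all these $\lambda$ $$ \bar T(j\lambda)^{-1}T(j\lambda)=K(j\lambda), $$ and $\bar T(s)^{-1}T(s)=K(s)$ at every $s\in\mathbb C$ that is not an eigenvalue of $F$ or of $\bar F$ and at which $\bar T(s)$ is nonsingular. Thus $\bar T^{-1}T$ extends to the inner function $K$, and $K$ does not depend on the choice of the linear output functional $\eta$. -/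

import Mathlib

open MeasureTheory

/-- A (real, square integrable) vector process, as a curve in the stochastic Hilbert space
`L²(Ω, P)`: `X t i` is the `i`-th component at time `t`. -/
abbrev L2Curve {Ω : Type*} [MeasurableSpace Ω] (P : Measure Ω) (ι : Type*) : Type _ :=
  ℝ → ι → Lp ℝ 2 P

/-- Normalized `r`-dimensional Wiener process on the whole time line, in the wide sense: its
increments are centered, increments over non-overlapping intervals are uncorrelated, and
`E (w t - w s) (w t - w s)ᵀ = |t - s| I`.  (Gaussianness is not required.) Only increments of `w`
matter. A forward and a backward Wiener process on `ℝ` both have these properties; they differ in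
the direction in which they drive the state. -/
structure IsWiener {Ω : Type*} [MeasurableSpace Ω] {P : Measure Ω} {r : ℕ}
    (w : L2Curve P (Fin r)) : Prop where
  centered : ∀ s t k, ∫ ω, (w t k - w s k : Lp ℝ 2 P) ω ∂P = 0
  orthogonal : ∀ s t u v : ℝ, s ≤ t → t ≤ u → u ≤ v → ∀ k l,
    inner ℝ (w t k - w s k) (w v l - w u l) = 0
  variance : ∀ s t k l,
    inner ℝ (w t k - w s k) (w t l - w s l) = if k = l then |t - s| else 0

/-- Stationary, mean-square continuous process (wide sense). -/
structure IsWideSenseStationary {Ω : Type*} [MeasurableSpace Ω] {P : Measure Ω} {n : ℕ}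
    (x : L2Curve P (Fin n)) : Prop where
  continuous : ∀ i, Continuous fun t => x t i
  mean : ∀ s t i, ∫ ω, x t i ω ∂P = ∫ ω, x s i ω ∂P
  covariance : ∀ h s t i j, inner ℝ (x (t + h) i) (x (s + h) j) = inner ℝ (x t i) (x s j)

/-- `dη = C x dt + D dw` in integrated form,
`η t - η s = ∫ τ in s..t, C x τ dτ + D (w t - w s)` for all `s`, `t`
(the integral is the mean-square one, i.e. the Bochner integral in `L²(Ω, P)`).
With `η = x` this is the linear stochastic differential equation `dx = C x dt + D dw`. -/
def HasDifferential {Ω : Type*} [MeasurableSpace Ω] {P : Measure Ω} {m n r : ℕ}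
    (η : L2Curve P (Fin m)) (x : L2Curve P (Fin n)) (w : L2Curve P (Fin r))
    (C : Matrix (Fin m) (Fin n) ℝ) (D : Matrix (Fin m) (Fin r) ℝ) : Prop :=
  ∀ (s t : ℝ) (i : Fin m),
    η t i - η s i = (∫ τ in s..t, ∑ j, C i j • x τ j) + ∑ k, D i k • (w t k - w s k)

/-- A forward Markovian representation `dx = F x dt + G dw`: `w` is a Wiener process, `x` is
stationary and all the eigenvalues of `F` have negative real part.
Then `x t = ∫_{-∞}^t e^{F (t - τ)} G dw τ`, so that `x` is a Markov process and the future
increments of `w` are uncorrelated with the past of `x`. -/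
structure IsForwardRep {Ω : Type*} [MeasurableSpace Ω] {P : Measure Ω} {n r : ℕ}
    (x : L2Curve P (Fin n)) (w : L2Curve P (Fin r))
    (F : Matrix (Fin n) (Fin n) ℝ) (G : Matrix (Fin n) (Fin r) ℝ) : Prop where
  wiener : IsWiener w
  stationary : IsWideSenseStationary x
  stable : ∀ z ∈ spectrum ℂ (F.map Complex.ofReal), z.re < 0
  dynamics : HasDifferential x x w F G

/-- A backward Markovian representation `dx = F x dt + G dw`: as above, but all the eigenvalues of
`F` have positive real part.
Then `x t = - ∫_t^∞ e^{F (t - τ)} G dw τ`, so that the past increments of `w` are uncorrelated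
with the future of `x`. -/
structure IsBackwardRep {Ω : Type*} [MeasurableSpace Ω] {P : Measure Ω} {n r : ℕ}
    (x : L2Curve P (Fin n)) (w : L2Curve P (Fin r))
    (F : Matrix (Fin n) (Fin n) ℝ) (G : Matrix (Fin n) (Fin r) ℝ) : Prop where
  wiener : IsWiener w
  stationary : IsWideSenseStationary x
  antistable : ∀ z ∈ spectrum ℂ (F.map Complex.ofReal), 0 < z.re
  dynamics : HasDifferential x x w F G

/-- The transfer function `C (s I - F)⁻¹ G + D`. Meaningful when `s` is not an eigenvalue
of `F`. -/
noncomputable def transfer {m n r : ℕ}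
    (C : Matrix (Fin m) (Fin n) ℝ) (F : Matrix (Fin n) (Fin n) ℝ)
    (G : Matrix (Fin n) (Fin r) ℝ) (D : Matrix (Fin m) (Fin r) ℝ) (s : ℂ) :
    Matrix (Fin m) (Fin r) ℂ :=
  C.map Complex.ofReal * (s • (1 : Matrix (Fin n) (Fin n) ℂ) - F.map Complex.ofReal)⁻¹
    * G.map Complex.ofReal + D.map Complex.ofReal

/-- A square transfer function is invertible (as a matrix of rational functions): its determinant
does not vanish at some point that is not an eigenvalue of `F`. -/
def TransferInvertible {n r : ℕ}
    (C : Matrix (Fin r) (Fin n) ℝ) (F : Matrix (Fin n) (Fin n) ℝ)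
    (G : Matrix (Fin n) (Fin r) ℝ) (D : Matrix (Fin r) (Fin r) ℝ) : Prop :=
  ∃ s : ℂ, s ∉ spectrum ℂ (F.map Complex.ofReal) ∧ (transfer C F G D s).det ≠ 0

/-- The measure `dλ / 2π` on the frequency axis. -/
noncomputable def freqMeasure : Measure ℝ :=
  ENNReal.ofReal (1 / (2 * Real.pi)) • volume

/-- The space of `ℂ^r`-valued functions of frequency, square integrable for `dλ / 2π`. -/
abbrev FreqL2 (r : ℕ) : Type := Lp (EuclideanSpace ℂ (Fin r)) 2 freqMeasure

/-- `J` is the stochastic integral `f ↦ ∑ k, ∫ f_k dŵ_k` with respect to the Fourier transform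
`dŵ` of the Wiener process `w`. That `J` is a linear isometry says that `dŵ` is an orthogonal
stochastic measure with `E dŵ dŵ* = I dλ / 2π` (namely `ŵ_k (Δ) = J (1_Δ e_k)`); the condition is
the spectral representation
`w_k t - w_k s = ∫ (exp (i λ t) - exp (i λ s)) / (i λ) dŵ_k(i λ)` of the increments. -/
def IsFourierTransform {Ω : Type*} [MeasurableSpace Ω] {P : Measure Ω} {r : ℕ}
    (w : L2Curve P (Fin r)) (J : FreqL2 r →ₗᵢ[ℂ] Lp ℂ 2 P) : Prop :=
  ∀ (s t : ℝ) (k : Fin r), ∃ g : FreqL2 r,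
    (∀ᵐ l ∂freqMeasure, g l = EuclideanSpace.single k
      ((Complex.exp (Complex.I * l * t) - Complex.exp (Complex.I * l * s)) / (Complex.I * l))) ∧
    J g = Complex.ofRealCLM.compLp (w t k - w s k)

/-- `K` (a matrix function of the frequency `λ`) is the transfer function from `w` to `w'`:
`dŵ'(i λ) = K(i λ) dŵ(i λ)`, i.e. `∫ f dŵ' = ∫ f K dŵ` for every square integrable row vector
function `f`. For a forward and a backward noise of the same state this is the scattering
function (on the imaginary axis). -/
def IsScatteringFunction {Ω : Type*} [MeasurableSpace Ω] {P : Measure Ω} {r : ℕ}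
    (w w' : L2Curve P (Fin r)) (K : ℝ → Matrix (Fin r) (Fin r) ℂ) : Prop :=
  ∃ J J' : FreqL2 r →ₗᵢ[ℂ] Lp ℂ 2 P, IsFourierTransform w J ∧ IsFourierTransform w' J' ∧
    ∀ f : FreqL2 r, ∃ g : FreqL2 r,
      (∀ᵐ l ∂freqMeasure, ∀ k, g l k = ∑ j, f l j * K l j k) ∧ J' f = J g

/-- `K` is a real rational matrix inner function: `K = N / d` with real polynomials, where `d` has
no zeros in the closed right half plane; `K` is contractive in the open right half plane and
unitary on the imaginary axis. -/
def IsRationalInner {r : ℕ} (K : ℂ → Matrix (Fin r) (Fin r) ℂ) : Prop :=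
  (∃ (N : Matrix (Fin r) (Fin r) (Polynomial ℝ)) (d : Polynomial ℝ),
    (∀ s : ℂ, 0 ≤ s.re → Polynomial.aeval s d ≠ 0) ∧
    ∀ s : ℂ, Polynomial.aeval s d ≠ 0 →
      ∀ i j, K s i j = Polynomial.aeval s (N i j) / Polynomial.aeval s d) ∧
  (∀ s : ℂ, 0 < s.re → ∀ v : Fin r → ℂ,
    ∑ k, ‖(K s).mulVec v k‖ ^ 2 ≤ ∑ k, ‖v k‖ ^ 2) ∧
  (∀ l : ℝ, K (Complex.I * l) ∈ Matrix.unitaryGroup (Fin r) ℂ)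

/-! The backward noise is itself a linear output of the forward representation. Subtracting the two
equations for `x` gives `G' dw' = (F - F') x dt + G dw`. If a row `a` annihilates `G'`, then `a (F -
F') x dt + a G dw = 0`. Over a short time `t` the noise term has norm of order `√t`, while the drift
has norm of order `t`, so `a G = 0`. As `G` has full column rank, so has `G'`, and a left inverse
`L` of `G'` gives `dw' = L (F - F') x dt + L G dw` (`exists_noise_hasDifferential`). The function
`K` is the transfer function of this output. It is real rational, and its poles lie among the
eigenvalues of `F`, in the open left half plane.

The rest takes place in the frequency domain. By Plancherel the increment kernels have the same Gram
matrix as the increments of a Wiener process, and they are total in `L²`. So there is exactly one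
isometry `J` realizing the Fourier transform of the noise (`IsWiener.exists_isFourierTransform`,
`IsFourierTransform.unique`). The state is `J` applied to the rows of `exp (i λ t) (i λ - F)⁻¹ G`:
the difference of the two is a bounded solution of `dz = F z dt`, hence zero because `F` has no
imaginary eigenvalue (`complexify_state`). The increments of any output are therefore `J` of the
kernel times the rows of its transfer function (`complexify_output`).

For the output `w'` this reads `J' f = J (f K)`. Both `J` and `J'` are isometric, so multiplication
by `K` is isometric and `K` is unitary on the axis (`transfer_mem_unitaryGroup`). Phragmén–Lindelöf
then makes it contractive in the right half plane (`transfer_contractive`). For a common output `η`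
the two spectral representations give `T = T' K` almost everywhere on the axis. After clearing
denominators this is an identity between polynomials, so it holds at every regular point, and its
determinant transfers invertibility from `T` to `T'`. -/

/-! ### The frequency kernels of the increments of a Wiener process -/

section Fourier

open FourierTransform SchwartzMap TemperedDistribution
open scoped ContDiff

/-- On `L¹ ∩ L²` the inverse Fourier transform on `L²` is the inverse Fourier integral. -/
theorem fourierInv_toLp_ae_eq {f : ℝ → ℂ} (hf : Integrable f) (hf2 : MemLp f 2) :
    (𝓕⁻ (hf2.toLp f) : Lp ℂ 2 (volume : Measure ℝ)) =ᵐ[volume] 𝓕⁻ f := by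
  have hcont : Continuous (𝓕⁻ f) := by
    have := VectorFourier.fourierIntegral_continuous (μ := volume) (L := -innerₗ ℝ)
      (f := f) Real.continuous_fourierChar (by simpa using by fun_prop) hf
    exact this
  refine ae_eq_of_integral_contDiff_smul_eq
    ((Lp.memLp _).locallyIntegrable (by norm_num)) hcont.locallyIntegrable ?_
  intro g g_smooth g_cpt
  have hg₁ : HasCompactSupport (Complex.ofRealCLM ∘ g) := g_cpt.comp_left rfl
  have hg₂ : ContDiff ℝ ∞ (Complex.ofRealCLM ∘ g) := by fun_prop
  set φ : 𝓢(ℝ, ℂ) := hg₁.toSchwartzMap hg₂ with hφ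
  have hφg : ∀ x, φ x = (g x : ℂ) := fun x => rfl
  have h1 : ∫ x, g x • (𝓕⁻ (hf2.toLp f) : Lp ℂ 2 (volume : Measure ℝ)) x =
      ∫ x, (𝓕⁻ φ) x • f x := by
    have := congrArg (fun T : 𝓢'(ℝ, ℂ) => T φ)
      (Lp.fourierInv_toTemperedDistribution_eq (hf2.toLp f))
    simp only [TemperedDistribution.fourierInv_apply, Lp.toTemperedDistribution_apply] at this
    refine Eq.trans ?_ (this.symm.trans ?_)
    · simp [hφg]
    · refine integral_congr_ae ?_
      filter_upwards [hf2.coeFn_toLp] with x hx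
      rw [hx]
  -- The inverse Fourier integral is symmetric for the bilinear pairing, by Fubini; the pairing
  -- `-innerₗ ℝ` equals its own flip.
  have h2 : ∫ x, (𝓕⁻ φ) x • f x = ∫ x, φ x • (𝓕⁻ f) x := by
    have := VectorFourier.integral_fourierIntegral_smul_eq_flip (μ := volume) (ν := volume)
      (L := -innerₗ ℝ) (f := fun x => φ x) (g := f) Real.continuous_fourierChar
      (by simpa using by fun_prop) φ.integrable hf
    have hflip : (-innerₗ ℝ : ℝ →ₗ[ℝ] ℝ →ₗ[ℝ] ℝ).flip = -innerₗ ℝ := by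
      ext; simp
    rw [hflip] at this
    rw [SchwartzMap.fourierInv_coe]
    exact this
  rw [h1, h2]
  simp [hφg]

end Fourier

/-- The frequency kernel `(exp (i λ t) - exp (i λ s)) / (i λ)` of the increment over `[s, t]`. -/
noncomputable def incrementKernel (s t l : ℝ) : ℂ :=
  (Complex.exp (Complex.I * l * t) - Complex.exp (Complex.I * l * s)) / (Complex.I * l)

theorem measurable_incrementKernel (s t : ℝ) : Measurable (incrementKernel s t) := by
  unfold incrementKernel
  fun_prop

/-- At `l = 0` division by zero makes the kernel `0` instead of `t - s`; hence the exclusion,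
harmless for statements up to null sets. -/
theorem incrementKernel_eq_integral (s t : ℝ) {l : ℝ} (hl : l ≠ 0) :
    incrementKernel s t l = ∫ τ in s..t, Complex.exp (Complex.I * l * τ) := by
  rw [integral_exp_mul_complex (by simpa using hl)]
  rfl

theorem norm_exp_I_mul_mul (l t : ℝ) : ‖Complex.exp (Complex.I * l * t)‖ = 1 := by
  have : Complex.I * l * t = ((l * t : ℝ) : ℂ) * Complex.I := by push_cast; ring
  rw [this, Complex.norm_exp_ofReal_mul_I]

theorem norm_incrementKernel_le (s t l : ℝ) : ‖incrementKernel s t l‖ ≤ |t - s| := by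
  rcases eq_or_ne l 0 with rfl | hl
  · simp [incrementKernel]
  · rw [incrementKernel_eq_integral s t hl]
    have := intervalIntegral.norm_integral_le_of_norm_le_const (a := s) (b := t) (C := 1)
      (f := fun τ : ℝ => Complex.exp (Complex.I * l * τ))
      (fun τ _ => (norm_exp_I_mul_mul l τ).le)
    simpa using this

theorem incrementKernel_mul (s t l : ℝ) :
    incrementKernel s t l * (Complex.I * l) =
      Complex.exp (Complex.I * l * t) - Complex.exp (Complex.I * l * s) := by
  rcases eq_or_ne l 0 with rfl | hl
  · simp
  · rw [incrementKernel, div_mul_cancel₀]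
    simpa using hl

/-- A zero of the kernel forces `exp (i λ) = 1`, so the zeros lie in the null set `2πℤ`. This
permits cancelling the kernel in identities between rows of transfer functions. -/
theorem incrementKernel_ne_zero_ae : ∀ᵐ l : ℝ, incrementKernel 0 1 l ≠ 0 := by
  have hc : {l : ℝ | incrementKernel 0 1 l = 0} ⊆
      Set.range (fun k : ℤ => (k : ℝ) * (2 * Real.pi)) := by
    intro l hl
    have h := incrementKernel_mul 0 1 l
    rw [Set.mem_ofPred_eq.mp hl] at h
    simp only [zero_mul, Complex.ofReal_one, mul_one, Complex.ofReal_zero, mul_zero,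
      Complex.exp_zero] at h
    obtain ⟨k, hk⟩ := Complex.exp_eq_one_iff.mp (sub_eq_zero.mp h.symm)
    refine ⟨k, ?_⟩
    have h3 := congrArg Complex.im hk
    simp at h3
    simpa using h3.symm
  rw [ae_iff]
  simpa using measure_mono_null hc ((Set.countable_range _).measure_zero volume)

theorem map_two_pi_volume :
    (volume : Measure ℝ).map (fun ξ => 2 * Real.pi * ξ) = freqMeasure := by
  rw [Real.map_volume_mul_left (by positivity), freqMeasure]
  congr 2
  rw [abs_of_pos (by positivity), one_div]

theorem measurePreserving_two_pi :
    MeasurePreserving (fun ξ : ℝ => 2 * Real.pi * ξ) volume freqMeasure :=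
  ⟨by fun_prop, map_two_pi_volume⟩

theorem measurableEmbedding_two_pi : MeasurableEmbedding (fun ξ : ℝ => 2 * Real.pi * ξ) :=
  (Homeomorph.mulLeft₀ (2 * Real.pi) (by positivity)).measurableEmbedding

theorem ae_freqMeasure_iff {p : ℝ → Prop} : (∀ᵐ l ∂freqMeasure, p l) ↔ ∀ᵐ l, p l := by
  have h : ENNReal.ofReal (1 / (2 * Real.pi)) ≠ 0 := by
    rw [Ne, ENNReal.ofReal_eq_zero, not_le]; positivity
  rw [freqMeasure, Measure.ae_ennreal_smul_measure_iff h]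

open FourierTransform in
theorem fourierInv_indicator_eq {s t : ℝ} (hst : s ≤ t) {ξ : ℝ} (hξ : ξ ≠ 0) :
    𝓕⁻ ((Set.Ioc s t).indicator (fun _ => (1 : ℂ))) ξ =
      incrementKernel s t (2 * Real.pi * ξ) := by
  rw [incrementKernel_eq_integral _ _ (by positivity), Real.fourierInv_eq',
    intervalIntegral.integral_of_le hst, ← integral_indicator measurableSet_Ioc]
  congr 1
  ext τ
  by_cases h : τ ∈ Set.Ioc s t
  · simp only [Set.indicator_of_mem h, smul_eq_mul, mul_one]
    congr 1
    simp
    ring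
  · simp [h]

theorem memLp_indicator_Ioc (s t : ℝ) :
    MemLp ((Set.Ioc s t).indicator (fun _ => (1 : ℂ))) 2 (volume : Measure ℝ) :=
  memLp_indicator_const _ measurableSet_Ioc _ (Or.inr (by simp))

open FourierTransform in
theorem fourierInv_indicator_ae_eq {s t : ℝ} (hst : s ≤ t) :
    (𝓕⁻ ((memLp_indicator_Ioc s t).toLp _) : Lp ℂ 2 (volume : Measure ℝ)) =ᵐ[volume]
      fun ξ => incrementKernel s t (2 * Real.pi * ξ) := by
  have h0 : ∀ᵐ ξ : ℝ, ξ ≠ 0 := by simp [ae_iff]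
  filter_upwards [fourierInv_toLp_ae_eq ((integrable_indicator_iff measurableSet_Ioc).mpr
    (integrable_const _)) (memLp_indicator_Ioc s t), h0] with ξ h1 h2
  rw [h1, fourierInv_indicator_eq hst h2]

theorem incrementKernel_symm (s t l : ℝ) :
    incrementKernel s t l = - incrementKernel t s l := by
  unfold incrementKernel; ring

open FourierTransform in
theorem memLp_incrementKernel_comp (s t : ℝ) :
    MemLp (fun ξ => incrementKernel s t (2 * Real.pi * ξ)) 2 (volume : Measure ℝ) := by
  wlog hst : s ≤ t generalizing s t
  · simp_rw [incrementKernel_symm s t]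
    exact (this t s (not_le.mp hst).le).neg
  exact (memLp_congr_ae (fourierInv_indicator_ae_eq hst)).mp (Lp.memLp _)

theorem memLp_incrementKernel (s t : ℝ) : MemLp (incrementKernel s t) 2 freqMeasure :=
  by
  rw [← map_two_pi_volume, measurableEmbedding_two_pi.memLp_map_measure_iff]
  exact memLp_incrementKernel_comp s t

open FourierTransform in
/-- Plancherel's theorem for the increment kernel. -/
theorem integral_norm_sq_incrementKernel (s t : ℝ) :
    ∫ l, ‖incrementKernel s t l‖ ^ 2 ∂freqMeasure = |t - s| := by
  wlog hst : s ≤ t generalizing s t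
  · simp_rw [incrementKernel_symm s t, norm_neg]
    rw [this t s (not_le.mp hst).le, abs_sub_comm]
  rw [← measurePreserving_two_pi.integral_comp measurableEmbedding_two_pi]
  have h1 : ∀ f : Lp ℂ 2 (volume : Measure ℝ), ‖f‖ ^ 2 = ∫ x, ‖f x‖ ^ 2 := by
    intro f
    have := @L2.inner_def ℝ ℂ ℂ _ _ _ _ _ f f
    rw [inner_self_eq_norm_sq_to_K] at this
    simp_rw [inner_self_eq_norm_sq_to_K] at this
    have h2 : ∀ x : ℝ, ((RCLike.ofReal x : ℂ)) = (x : ℂ) := fun _ => rfl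
    simp_rw [h2, ← Complex.ofReal_pow] at this
    rw [integral_complex_ofReal] at this
    exact_mod_cast this
  set u : Lp ℂ 2 (volume : Measure ℝ) := (memLp_indicator_Ioc s t).toLp _ with hu
  have h2 : ‖(𝓕⁻ u : Lp ℂ 2 (volume : Measure ℝ))‖ = ‖u‖ :=
    (Lp.fourierTransformₗᵢ ℝ ℂ).symm.norm_map u
  have h3 := h1 (𝓕⁻ u)
  rw [h2, h1] at h3
  have h4 : ∫ x, ‖(𝓕⁻ u : Lp ℂ 2 (volume : Measure ℝ)) x‖ ^ 2 =
      ∫ ξ, ‖incrementKernel s t (2 * Real.pi * ξ)‖ ^ 2 := by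
    refine integral_congr_ae ?_
    filter_upwards [fourierInv_indicator_ae_eq hst] with x hx
    rw [hx]
  rw [← h4, ← h3]
  have h5 : ∫ x, ‖u x‖ ^ 2 = ∫ x, (Set.Ioc s t).indicator (fun _ => (1 : ℝ)) x := by
    refine integral_congr_ae ?_
    filter_upwards [(memLp_indicator_Ioc s t).coeFn_toLp] with x hx
    rw [hu, hx]
    by_cases h : x ∈ Set.Ioc s t <;> simp [h]
  rw [h5, integral_indicator measurableSet_Ioc]
  simp [hst, abs_of_nonneg]

open FourierTransform ComplexConjugate in
/-- A square integrable function of frequency orthogonal to all increment kernels vanishes. -/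
theorem ae_eq_zero_of_integral_incrementKernel {h : ℝ → ℂ} (hh : MemLp h 2 freqMeasure)
    (horth : ∀ s t : ℝ, s ≤ t → ∫ l, conj (incrementKernel s t l) * h l ∂freqMeasure = 0) :
    ∀ᵐ l, h l = 0 := by
  have hh' : MemLp (fun ξ => h (2 * Real.pi * ξ)) 2 (volume : Measure ℝ) := by
    rw [← map_two_pi_volume, measurableEmbedding_two_pi.memLp_map_measure_iff] at hh
    exact hh
  -- `H` is `h` in the variable `ξ = λ / 2π`. By Parseval, orthogonality to the kernels says that
  -- its Fourier transform `V` has zero integral over every interval.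
  set H : Lp ℂ 2 (volume : Measure ℝ) := hh'.toLp _ with hH
  set V : Lp ℂ 2 (volume : Measure ℝ) := 𝓕 H with hV
  have hVi : ∀ a b, IntegrableOn V (Set.Ioc a b) := fun a b =>
    (((Lp.memLp V).locallyIntegrable (by norm_num)).integrableOn_isCompact
      isCompact_Icc).mono_set Set.Ioc_subset_Icc_self
  have hint : ∀ s t : ℝ, s ≤ t → ∫ x in s..t, V x = 0 := by
    intro s t hst
    set u : Lp ℂ 2 (volume : Measure ℝ) := (memLp_indicator_Ioc s t).toLp _ with hu
    have h1 : inner ℂ u V = 0 := by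
      have h2 : inner ℂ u V = inner ℂ (𝓕⁻ u : Lp ℂ 2 (volume : Measure ℝ)) H := by
        have := (Lp.fourierTransformₗᵢ ℝ ℂ).symm.inner_map_map u V
        rw [← this]
        congr 1
        exact (Lp.fourierTransformₗᵢ ℝ ℂ).symm_apply_apply H
      rw [h2, L2.inner_def]
      have h3 := horth s t hst
      rw [← measurePreserving_two_pi.integral_comp measurableEmbedding_two_pi] at h3
      rw [← h3]
      refine integral_congr_ae ?_
      filter_upwards [fourierInv_indicator_ae_eq hst, hh'.coeFn_toLp] with x hx hx'
      rw [hx, hH, hx', RCLike.inner_apply, mul_comm]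
    rw [L2.inner_def] at h1
    rw [intervalIntegral.integral_of_le hst, ← integral_indicator measurableSet_Ioc, ← h1]
    refine integral_congr_ae ?_
    filter_upwards [(memLp_indicator_Ioc s t).coeFn_toLp] with x hx
    rw [hu, hx]
    by_cases h : x ∈ Set.Ioc s t <;> simp [h]
  have hint' : ∀ s t : ℝ, ∫ x in s..t, V x = 0 := by
    intro s t
    rcases le_total s t with h | h
    · exact hint s t h
    · rw [intervalIntegral.integral_symm, hint t s h, neg_zero]
  -- Lebesgue differentiation: `V` is almost everywhere the derivative of its integral, which is
  -- identically zero.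
  have hV0 : V = 0 := by
    rw [Lp.eq_zero_iff_ae_eq_zero]
    filter_upwards [LocallyIntegrable.ae_hasDerivAt_integral
      ((Lp.memLp V).locallyIntegrable (by norm_num))]
      with x hx
    have h1 := hx 0
    simp_rw [hint'] at h1
    exact h1.unique (hasDerivAt_const x 0)
  have hH0 : H = 0 := by
    have : H = 𝓕⁻ V := ((Lp.fourierTransformₗᵢ ℝ ℂ).symm_apply_apply H).symm
    rw [this, hV0]
    exact (Lp.fourierTransformₗᵢ ℝ ℂ).symm.map_zero
  rw [← ae_freqMeasure_iff, ← map_two_pi_volume, measurableEmbedding_two_pi.ae_map_iff]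
  rw [Lp.eq_zero_iff_ae_eq_zero] at hH0
  filter_upwards [hH0, hh'.coeFn_toLp] with x hx hx'
  rw [← hx', ← hH, hx, Pi.zero_apply]

/-! ### The spectral isometry of a Wiener process -/

theorem memLp_single_incrementKernel {r : ℕ} (s t : ℝ) (k : Fin r) :
    MemLp (fun l => EuclideanSpace.single k (incrementKernel s t l)) 2 freqMeasure := by
  refine (memLp_incrementKernel s t).of_le ?_ (Filter.Eventually.of_forall fun l => by simp)
  refine Measurable.aestronglyMeasurable ?_
  have h := measurable_incrementKernel s t
  have h2 : Measurable fun z : ℂ => (EuclideanSpace.single k z : EuclideanSpace ℂ (Fin r)) :=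
    (LinearIsometry.continuous (LinearIsometry.mk
      (LinearMap.mk ⟨fun z => EuclideanSpace.single k z, by
        intro x y; ext i; by_cases hi : i = k <;> simp [hi]⟩ (by
        intro x y; ext i; by_cases hi : i = k <;> simp [hi]) : ℂ →ₗ[ℂ] EuclideanSpace ℂ (Fin r))
      (by intro x; simp))).measurable
  exact h2.comp h

/-- The increment kernel in the `k`-th component, as an element of `L²`. -/
noncomputable def kernelL2 {r : ℕ} (s t : ℝ) (k : Fin r) : FreqL2 r :=
  (memLp_single_incrementKernel s t k).toLp _

theorem kernelL2_ae {r : ℕ} (s t : ℝ) (k : Fin r) :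
    ∀ᵐ l ∂freqMeasure, kernelL2 s t k l = EuclideanSpace.single k (incrementKernel s t l) :=
  MemLp.coeFn_toLp _

theorem inner_kernelL2 {r : ℕ} (s t : ℝ) (k : Fin r) (g : FreqL2 r) :
    inner ℂ (kernelL2 s t k) g =
      ∫ l, (starRingEnd ℂ) (incrementKernel s t l) * g l k ∂freqMeasure := by
  rw [L2.inner_def]
  refine integral_congr_ae ?_
  filter_upwards [kernelL2_ae s t k] with l hl
  rw [hl, EuclideanSpace.inner_single_left]

theorem inner_kernelL2_of_ne {r : ℕ} (s t u v : ℝ) {k m : Fin r} (hkm : k ≠ m) :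
    inner ℂ (kernelL2 s t k) (kernelL2 u v m) = 0 := by
  rw [inner_kernelL2, ← integral_zero ℝ ℂ (μ := freqMeasure)]
  refine integral_congr_ae ?_
  filter_upwards [kernelL2_ae u v m] with l hl
  simp [hl, hkm]

theorem norm_sq_kernelL2 {r : ℕ} (s t : ℝ) (k : Fin r) : ‖kernelL2 s t k‖ ^ 2 = |t - s| := by
  have h := inner_kernelL2 s t k (kernelL2 s t k)
  rw [inner_self_eq_norm_sq_to_K] at h
  have h2 : ∫ l, (starRingEnd ℂ) (incrementKernel s t l) * kernelL2 s t k l k ∂freqMeasure =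
      ∫ l, ((‖incrementKernel s t l‖ ^ 2 : ℝ) : ℂ) ∂freqMeasure := by
    refine integral_congr_ae ?_
    filter_upwards [kernelL2_ae s t k] with l hl
    simp [hl, Complex.conj_mul']
  rw [h2, integral_complex_ofReal, integral_norm_sq_incrementKernel] at h
  have h3 : ((‖kernelL2 s t k‖ : ℝ) : ℂ) ^ 2 = ((|t - s| : ℝ) : ℂ) := h
  exact_mod_cast h3

theorem conj_incrementKernel (s t l : ℝ) :
    (starRingEnd ℂ) (incrementKernel s t l) = incrementKernel s t (-l) := by
  simp only [incrementKernel, map_div₀, map_sub, ← Complex.exp_conj, map_mul, Complex.conj_I,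
    Complex.conj_ofReal, Complex.ofReal_neg]
  ring_nf

/-- Conjugation replaces `λ` by `-λ` in the kernels and the measure is even. Only because these
products are real can they match the covariances of a real process. -/
theorem im_inner_kernelL2 {r : ℕ} (s t u v : ℝ) (k : Fin r) :
    (inner ℂ (kernelL2 s t k) (kernelL2 u v k)).im = 0 := by
  rw [← Complex.conj_eq_iff_im]
  have h : inner ℂ (kernelL2 s t k) (kernelL2 u v k) =
      ∫ l, incrementKernel s t (-l) * incrementKernel u v l ∂freqMeasure := by
    rw [inner_kernelL2]
    refine integral_congr_ae ?_
    filter_upwards [kernelL2_ae u v k] with l hl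
    simp [hl, conj_incrementKernel]
  rw [h, ← integral_conj, freqMeasure, integral_smul_measure, integral_smul_measure,
    ← integral_neg_eq_self]
  simp [conj_incrementKernel]

theorem kernelL2_sub {r : ℕ} (a s t : ℝ) (k : Fin r) :
    kernelL2 a t k - kernelL2 a s k = kernelL2 s t k := by
  refine Lp.ext ?_
  filter_upwards [Lp.coeFn_sub (kernelL2 a t k) (kernelL2 a s k), kernelL2_ae a t k,
    kernelL2_ae a s k, kernelL2_ae s t k] with l h1 h2 h3 h4
  rw [h1, Pi.sub_apply, h2, h3, h4]
  ext i
  by_cases hi : i = k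
  · simp [hi, incrementKernel]
    ring
  · simp [hi]

/-- Polarization of Plancherel's norm formula; the value is the covariance of Brownian motion on the
whole line. -/
theorem inner_kernelL2_zero {r : ℕ} (s t : ℝ) (k : Fin r) :
    inner ℂ (kernelL2 0 s k) (kernelL2 0 t k) = (((|s| + |t| - |t - s|) / 2 : ℝ) : ℂ) := by
  refine Complex.ext ?_ (by rw [im_inner_kernelL2, Complex.ofReal_im])
  have h := @norm_sub_sq ℂ _ _ _ _ (kernelL2 0 t k) (kernelL2 0 s k)
  rw [kernelL2_sub, norm_sq_kernelL2, norm_sq_kernelL2, norm_sq_kernelL2, inner_re_symm] at h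
  have h' : (inner ℂ (kernelL2 0 s k) (kernelL2 0 t k)).re =
    RCLike.re (inner ℂ (kernelL2 0 s k) (kernelL2 0 t k)) := rfl
  rw [h', Complex.ofReal_re]
  simp only [sub_zero] at h
  linarith

/-- Kernels starting at time `0` suffice, since the others are differences of them; each component
of an orthogonal function then vanishes separately. -/
theorem dense_span_kernelL2 (r : ℕ) :
    (Submodule.span ℂ (Set.range fun p : ℝ × Fin r => kernelL2 0 p.1 p.2)).topologicalClosure
      = ⊤ := by
  rw [Submodule.topologicalClosure_eq_top_iff, Submodule.eq_bot_iff]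
  intro g hg
  rw [Submodule.mem_orthogonal] at hg
  have h1 : ∀ s t k, inner ℂ (kernelL2 s t k) g = 0 := by
    intro s t k
    rw [← kernelL2_sub 0 s t k, inner_sub_left, hg _ (Submodule.subset_span ⟨(t, k), rfl⟩),
      hg _ (Submodule.subset_span ⟨(s, k), rfl⟩), sub_zero]
  rw [Lp.eq_zero_iff_ae_eq_zero]
  have h2 : ∀ k, ∀ᵐ l, g l k = 0 := by
    intro k
    refine ae_eq_zero_of_integral_incrementKernel (h := fun l => g l k) ?_ ?_
    · exact (Lp.memLp g).of_le
        ((EuclideanSpace.proj (𝕜 := ℂ) k).continuous.comp_aestronglyMeasurable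
          (Lp.aestronglyMeasurable g))
        (Filter.Eventually.of_forall fun l => PiLp.norm_apply_le (g l) k)
    · intro s t _
      rw [← inner_kernelL2, h1]
  have h3 := ae_freqMeasure_iff.mpr (ae_all_iff.mpr h2)
  filter_upwards [h3] with l hl
  ext k
  simpa using hl k

/-- Two families with the same Gram matrix, the first of them total, are related by a linear
isometry. -/
theorem exists_linearIsometry_of_gram {ι E H : Type*} [NormedAddCommGroup E]
    [InnerProductSpace ℂ E] [NormedAddCommGroup H] [InnerProductSpace ℂ H] [CompleteSpace H]
    (a : ι → E) (b : ι → H) (hdense : (Submodule.span ℂ (Set.range a)).topologicalClosure = ⊤)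
    (hgram : ∀ i j, inner ℂ (a i) (a j) = inner ℂ (b i) (b j)) :
    ∃ J : E →ₗᵢ[ℂ] H, ∀ i, J (a i) = b i := by
  set e := Finsupp.linearCombination ℂ a
  set f := Finsupp.linearCombination ℂ b
  have hd : DenseRange e := by
    have h1 : Set.range e = (Submodule.span ℂ (Set.range a) : Set E) := by
      rw [← Finsupp.range_linearCombination]; rfl
    rw [DenseRange, h1]
    exact Submodule.dense_iff_topologicalClosure_eq_top.mpr hdense
  have hinner : ∀ x, inner ℂ (e x) (e x) = inner ℂ (f x) (f x) := by
    intro x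
    simp only [e, f, Finsupp.linearCombination_apply, Finsupp.sum, inner_sum, sum_inner,
      inner_smul_left, inner_smul_right, hgram]
  have hnorm : ∀ x, ‖f x‖ = ‖e x‖ := by
    intro x
    have := hinner x
    rw [inner_self_eq_norm_sq_to_K, inner_self_eq_norm_sq_to_K] at this
    have h2 : ‖e x‖ ^ 2 = ‖f x‖ ^ 2 := by exact_mod_cast this
    exact ((sq_eq_sq₀ (norm_nonneg _) (norm_nonneg _)).mp h2).symm
  have hb : ∃ C, ∀ x, ‖f x‖ ≤ C * ‖e x‖ := ⟨1, fun x => by rw [hnorm, one_mul]⟩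
  -- The map `e x ↦ f x` is well defined and isometric on the span because `‖f x‖ = ‖e x‖`; `T` is
  -- its extension by density.
  set T := f.extendOfNorm e
  have hT : ∀ x, T (e x) = f x := LinearMap.extendOfNorm_eq hd hb
  have hTn : ∀ y, ‖T y‖ = ‖y‖ := by
    intro y
    refine hd.induction_on (p := fun y => ‖T y‖ = ‖y‖) y
      (isClosed_eq T.continuous.norm continuous_norm) fun x => ?_
    rw [hT, hnorm]
  refine ⟨⟨T.toLinearMap, hTn⟩, fun i => ?_⟩
  have := hT (Finsupp.single i 1)
  simpa [e, f] using this

/-- The embedding of real into complex `L²`. -/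
noncomputable def complexify {Ω : Type*} [MeasurableSpace Ω] (P : Measure Ω) :
    Lp ℝ 2 P →L[ℝ] Lp ℂ 2 P :=
  Complex.ofRealCLM.compLpL 2 P

theorem complexify_apply {Ω : Type*} [MeasurableSpace Ω] {P : Measure Ω} (f : Lp ℝ 2 P) :
    complexify P f = Complex.ofRealCLM.compLp f := rfl

theorem inner_complexify {Ω : Type*} [MeasurableSpace Ω] {P : Measure Ω} (f g : Lp ℝ 2 P) :
    inner ℂ (complexify P f) (complexify P g) = ((inner ℝ f g : ℝ) : ℂ) := by
  rw [L2.inner_def, L2.inner_def, ← integral_complex_ofReal]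
  refine integral_congr_ae ?_
  filter_upwards [Complex.ofRealCLM.coeFn_compLp f, Complex.ofRealCLM.coeFn_compLp g] with x h1 h2
  rw [complexify_apply, complexify_apply, h1, h2]
  simp

theorem norm_complexify {Ω : Type*} [MeasurableSpace Ω] {P : Measure Ω} (f : Lp ℝ 2 P) :
    ‖complexify P f‖ = ‖f‖ := by
  have h := inner_complexify f f
  rw [inner_self_eq_norm_sq_to_K, real_inner_self_eq_norm_sq] at h
  have h2 : ‖complexify P f‖ ^ 2 = ‖f‖ ^ 2 := by
    refine Complex.ofReal_injective ?_
    rw [← h, Complex.ofReal_pow]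
    rfl
  exact (sq_eq_sq₀ (norm_nonneg _) (norm_nonneg _)).mp h2

theorem complexify_smul {Ω : Type*} [MeasurableSpace Ω] {P : Measure Ω} (c : ℝ) (f : Lp ℝ 2 P) :
    complexify P (c • f) = (c : ℂ) • complexify P f := by
  rw [map_smul]
  exact (Complex.coe_smul c _).symm

/-! ### Existence and uniqueness of the spectral isometry -/

section Wiener

variable {Ω : Type*} [MeasurableSpace Ω] {P : Measure Ω} {r : ℕ} {w : L2Curve P (Fin r)}

theorem isFourierTransform_iff {J : FreqL2 r →ₗᵢ[ℂ] Lp ℂ 2 P} :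
    IsFourierTransform w J ↔
      ∀ s t k, J (kernelL2 s t k) = complexify P (w t k - w s k) := by
  refine ⟨fun h s t k => ?_, fun h s t k => ⟨kernelL2 s t k, kernelL2_ae s t k, h s t k⟩⟩
  obtain ⟨g, hg, hJ⟩ := h s t k
  have : kernelL2 s t k = g := by
    refine Lp.ext ?_
    filter_upwards [kernelL2_ae s t k, hg] with l h1 h2
    rw [h1, h2]; rfl
  rw [this, hJ]; rfl

/-- The axioms cover equal and non-overlapping intervals only. When the intervals from `0` to `s`
and to `t` overlap, the longer one is cut at the endpoint of the shorter. -/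
theorem IsWiener.inner_eq_zero_of_ne (hw : IsWiener w) (s t : ℝ) {k l : Fin r} (hkl : k ≠ l) :
    inner ℝ (w s k - w 0 k) (w t l - w 0 l) = 0 := by
  wlog hst : s ≤ t generalizing s t k l
  · rw [real_inner_comm]
    exact this t s hkl.symm (not_le.mp hst).le
  rcases le_total 0 s with hs | hs
  · have h1 := hw.variance 0 s k l
    have h2 := hw.orthogonal 0 s s t hs le_rfl hst k l
    rw [if_neg hkl] at h1
    rw [← sub_add_sub_cancel (w t l) (w s l) (w 0 l), inner_add_right, h1, h2, add_zero]
  · rcases le_total 0 t with ht | ht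
    · have h1 := hw.orthogonal s 0 0 t hs le_rfl ht k l
      rw [← neg_sub, inner_neg_left, h1, neg_zero]
    · have h1 := hw.orthogonal s t t 0 hst le_rfl ht k l
      have h2 := hw.variance t 0 k l
      rw [if_neg hkl] at h2
      rw [← neg_sub (w 0 k), ← neg_sub (w 0 l), inner_neg_neg,
        ← sub_add_sub_cancel (w 0 k) (w t k) (w s k), inner_add_left, h1, h2, add_zero]

theorem IsWiener.inner_eq (hw : IsWiener w) (s t : ℝ) (k : Fin r) :
    inner ℝ (w s k - w 0 k) (w t k - w 0 k) = (|s| + |t| - |t - s|) / 2 := by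
  have h1 := hw.variance 0 s k k
  have h2 := hw.variance 0 t k k
  have h3 := hw.variance s t k k
  rw [if_pos rfl, real_inner_self_eq_norm_sq] at h1 h2 h3
  have h4 := norm_sub_sq_real (w t k - w 0 k) (w s k - w 0 k)
  rw [sub_sub_sub_cancel_right, h1, h2, h3, real_inner_comm, sub_zero, sub_zero] at h4
  linarith

/-- Existence of the spectral isometry of a Wiener process. -/
theorem IsWiener.exists_isFourierTransform (hw : IsWiener w) :
    ∃ J : FreqL2 r →ₗᵢ[ℂ] Lp ℂ 2 P, IsFourierTransform w J := by
  obtain ⟨J, hJ⟩ := exists_linearIsometry_of_gram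
    (fun p : ℝ × Fin r => kernelL2 0 p.1 p.2)
    (fun p => complexify P (w p.1 p.2 - w 0 p.2)) (dense_span_kernelL2 r) (by
      rintro ⟨s, k⟩ ⟨t, l⟩
      rw [inner_complexify]
      rcases eq_or_ne k l with rfl | hkl
      · rw [hw.inner_eq, inner_kernelL2_zero]
      · rw [hw.inner_eq_zero_of_ne s t hkl, inner_kernelL2_of_ne 0 s 0 t hkl, Complex.ofReal_zero])
  refine ⟨J, isFourierTransform_iff.mpr fun s t k => ?_⟩
  have h1 := hJ (s, k)
  have h2 := hJ (t, k)
  simp only at h1 h2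
  rw [← kernelL2_sub 0 s t k, map_sub, h1, h2, ← map_sub, sub_sub_sub_cancel_right]

/-- Continuous linear maps on `FreqL2 r` are determined by their values at the kernels. -/
theorem freqL2_clm_ext {H : Type*} [NormedAddCommGroup H] [NormedSpace ℂ H]
    {S T : FreqL2 r →L[ℂ] H} (h : ∀ s t k, S (kernelL2 s t k) = T (kernelL2 s t k)) : S = T := by
  refine ContinuousLinearMap.ext_on
    (Submodule.dense_iff_topologicalClosure_eq_top.mpr (dense_span_kernelL2 r)) ?_
  rintro _ ⟨p, rfl⟩
  exact h _ _ _

/-- The values on the kernels are prescribed, and the kernels are total. -/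
theorem IsFourierTransform.unique {J J' : FreqL2 r →ₗᵢ[ℂ] Lp ℂ 2 P}
    (h : IsFourierTransform w J) (h' : IsFourierTransform w J') : J = J' := by
  have : J.toContinuousLinearMap = J'.toContinuousLinearMap := by
    refine freqL2_clm_ext fun s t k => ?_
    exact (isFourierTransform_iff.mp h s t k).trans (isFourierTransform_iff.mp h' s t k).symm
  ext1 x
  exact congrArg (fun T : FreqL2 r →L[ℂ] Lp ℂ 2 P => T x) this

end Wiener

/-! ### Multiplication operators on the frequency axis -/

section Multiplier

variable {r : ℕ}

theorem norm_sq_freqL2 (f : FreqL2 r) : ‖f‖ ^ 2 = ∫ l, ‖f l‖ ^ 2 ∂freqMeasure := by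
  have h := L2.inner_def (𝕜 := ℂ) f f
  rw [inner_self_eq_norm_sq_to_K] at h
  simp_rw [inner_self_eq_norm_sq_to_K] at h
  have h2 : ∀ x : ℝ, ((RCLike.ofReal x : ℂ)) = (x : ℂ) := fun _ => rfl
  simp_rw [h2, ← Complex.ofReal_pow] at h
  rw [integral_complex_ofReal] at h
  exact_mod_cast h

theorem integrable_norm_sq_freqL2 (f : FreqL2 r) :
    Integrable (fun l => ‖f l‖ ^ 2) freqMeasure :=
  (memLp_two_iff_integrable_sq_norm (Lp.aestronglyMeasurable f)).mp (Lp.memLp f)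

/-- A measurable bounded field of operators on `ℂ^r`, indexed by the frequency. -/
structure IsBoundedField
    (B : ℝ → EuclideanSpace ℂ (Fin r) →L[ℂ] EuclideanSpace ℂ (Fin r)) : Prop where
  measurable : StronglyMeasurable B
  bounded : ∃ M, ∀ l, ‖B l‖ ≤ M

variable {B : ℝ → EuclideanSpace ℂ (Fin r) →L[ℂ] EuclideanSpace ℂ (Fin r)}

theorem IsBoundedField.memLp (hB : IsBoundedField B) (f : FreqL2 r) :
    MemLp (fun l => B l (f l)) 2 freqMeasure := by
  obtain ⟨M, hM⟩ := hB.bounded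
  refine (Lp.memLp f).of_le_mul (c := M) ?_ (Filter.Eventually.of_forall fun l => ?_)
  · exact isBoundedBilinearMap_apply.continuous.comp_aestronglyMeasurable
      (hB.measurable.aestronglyMeasurable.prodMk (Lp.aestronglyMeasurable f))
  · exact (B l).le_of_opNorm_le (hM l) _

/-- Pointwise application of a bounded field of operators. -/
noncomputable def fieldMul (hB : IsBoundedField B) : FreqL2 r →L[ℂ] FreqL2 r :=
  LinearMap.mkContinuousOfExistsBound
    { toFun := fun f => (hB.memLp f).toLp _
      map_add' := fun f g => by
        rw [← MemLp.toLp_add]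
        refine MemLp.toLp_congr _ _ ?_
        filter_upwards [Lp.coeFn_add f g] with l hl
        change B l ((f + g : FreqL2 r) l) = B l (f l) + B l (g l)
        rw [hl, Pi.add_apply, map_add]
      map_smul' := fun c f => by
        rw [RingHom.id_apply, ← MemLp.toLp_const_smul]
        refine MemLp.toLp_congr _ _ ?_
        filter_upwards [Lp.coeFn_smul c f] with l hl
        change B l ((c • f : FreqL2 r) l) = c • B l (f l)
        rw [hl, Pi.smul_apply, map_smul] }
    (by
      obtain ⟨M, hM⟩ := hB.bounded
      refine ⟨M, fun f => ?_⟩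
      refine Lp.norm_le_mul_norm_of_ae_le_mul ?_
      filter_upwards [(hB.memLp f).coeFn_toLp] with l hl
      simp only [LinearMap.coe_mk, AddHom.coe_mk]
      rw [hl]
      exact (B l).le_of_opNorm_le (hM l) _)

theorem fieldMul_ae (hB : IsBoundedField B) (f : FreqL2 r) :
    ∀ᵐ l ∂freqMeasure, fieldMul hB f l = B l (f l) :=
  (hB.memLp f).coeFn_toLp

theorem isBoundedField_smul_id {m : ℝ → ℂ} (hm : Measurable m) {M : ℝ} (hM : ∀ l, ‖m l‖ ≤ M) :
    IsBoundedField (r := r) fun l => m l • ContinuousLinearMap.id ℂ _ := by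
  refine ⟨hm.stronglyMeasurable.smul_const _, M, fun l => ?_⟩
  rw [norm_smul]
  refine (mul_le_of_le_one_right (norm_nonneg _) ContinuousLinearMap.norm_id_le).trans (hM l)

theorem measurable_exp_I_mul_mul (t : ℝ) :
    Measurable fun l : ℝ => Complex.exp (Complex.I * l * t) := by fun_prop

/-- Multiplication by `exp (i λ t)`: the time shift in the frequency domain. -/
noncomputable def shift (t : ℝ) : FreqL2 r →L[ℂ] FreqL2 r :=
  fieldMul (isBoundedField_smul_id (measurable_exp_I_mul_mul t)
    fun l => (norm_exp_I_mul_mul l t).le)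

/-- Multiplication by the increment kernel. -/
noncomputable def kernelMul (s t : ℝ) : FreqL2 r →L[ℂ] FreqL2 r :=
  fieldMul (isBoundedField_smul_id (measurable_incrementKernel s t)
    (norm_incrementKernel_le s t))

theorem shift_ae (t : ℝ) (f : FreqL2 r) :
    ∀ᵐ l ∂freqMeasure, shift t f l = Complex.exp (Complex.I * l * t) • f l :=
  fieldMul_ae _ f

theorem kernelMul_ae (s t : ℝ) (f : FreqL2 r) :
    ∀ᵐ l ∂freqMeasure, kernelMul s t f l = incrementKernel s t l • f l :=
  fieldMul_ae _ f

theorem norm_shift (t : ℝ) (f : FreqL2 r) : ‖shift t f‖ = ‖f‖ := by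
  refine (sq_eq_sq₀ (norm_nonneg _) (norm_nonneg _)).mp ?_
  rw [norm_sq_freqL2, norm_sq_freqL2]
  refine integral_congr_ae ?_
  filter_upwards [shift_ae t f] with l hl
  rw [hl, norm_smul, norm_exp_I_mul_mul, one_mul]

/-- Dominated convergence for scalar multipliers. -/
theorem tendsto_zero_of_multiplier {ι : Type*} {u : Filter ι} [u.IsCountablyGenerated]
    (ψ : FreqL2 r) {m : ι → ℝ → ℂ} {f : ι → FreqL2 r} {C : ℝ}
    (hf : ∀ n, ∀ᵐ l ∂freqMeasure, f n l = m n l • ψ l)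
    (hC : ∀ᶠ n in u, ∀ l, ‖m n l‖ ≤ C)
    (hlim : ∀ᵐ l, Filter.Tendsto (fun n => m n l) u (nhds 0)) :
    Filter.Tendsto f u (nhds 0) := by
  have h1 : Filter.Tendsto (fun n => ∫ l, ‖m n l • ψ l‖ ^ 2 ∂freqMeasure) u
      (nhds (∫ _, (0 : ℝ) ∂freqMeasure)) := by
    refine tendsto_integral_filter_of_dominated_convergence (fun l => C ^ 2 * ‖ψ l‖ ^ 2) ?_ ?_
      ((integrable_norm_sq_freqL2 ψ).const_mul _) ?_
    · refine Filter.Eventually.of_forall fun n => ?_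
      refine ((integrable_norm_sq_freqL2 (f n)).aestronglyMeasurable).congr ?_
      filter_upwards [hf n] with l hl
      rw [hl]
    · filter_upwards [hC] with n hn
      refine Filter.Eventually.of_forall fun l => ?_
      rw [norm_smul, mul_pow, Real.norm_of_nonneg (by positivity)]
      gcongr
      exact hn l
    · filter_upwards [ae_freqMeasure_iff.mpr hlim] with l hl
      have := ((hl.smul_const (ψ l)).norm.pow 2)
      simpa using this
  have h2 : ∀ n, ∫ l, ‖m n l • ψ l‖ ^ 2 ∂freqMeasure = ‖f n‖ ^ 2 := by
    intro n
    rw [norm_sq_freqL2]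
    refine integral_congr_ae ?_
    filter_upwards [hf n] with l hl
    rw [hl]
  simp_rw [h2, integral_zero] at h1
  have h3 := h1.sqrt
  simp only [Real.sqrt_sq (norm_nonneg _), Real.sqrt_zero] at h3
  exact tendsto_zero_iff_norm_tendsto_zero.mpr h3

/-- The convergence of `exp (i λ s)` as `s → t` is not uniform in `λ`, so continuity is obtained for
each fixed `ψ`, by dominated convergence. -/
theorem continuous_shift (ψ : FreqL2 r) : Continuous fun t => shift t ψ := by
  rw [continuous_iff_continuousAt]
  intro t
  rw [ContinuousAt, tendsto_iff_norm_sub_tendsto_zero, ← tendsto_zero_iff_norm_tendsto_zero]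
  refine tendsto_zero_of_multiplier (u := nhds t) ψ (C := 2)
    (m := fun (s l : ℝ) => Complex.exp (Complex.I * l * s) - Complex.exp (Complex.I * l * t)) ?_ ?_ ?_
  · intro s
    filter_upwards [Lp.coeFn_sub (shift s ψ) (shift t ψ), shift_ae s ψ, shift_ae t ψ]
      with l h1 h2 h3
    rw [h1, Pi.sub_apply, h2, h3, sub_smul]
  · refine Filter.Eventually.of_forall fun s l => (norm_sub_le _ _).trans ?_
    rw [norm_exp_I_mul_mul, norm_exp_I_mul_mul]
    norm_num
  · refine Filter.Eventually.of_forall fun l => ?_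
    have : Continuous fun s : ℝ =>
      Complex.exp (Complex.I * l * s) - Complex.exp (Complex.I * l * t) := by fun_prop
    simpa using this.tendsto t

theorem hasDerivAt_incrementKernel (s t : ℝ) {l : ℝ} (hl : l ≠ 0) :
    HasDerivAt (fun t => incrementKernel s t l) (Complex.exp (Complex.I * l * t)) t := by
  have h1 : HasDerivAt (fun t : ℝ => Complex.exp (Complex.I * l * t))
      (Complex.exp (Complex.I * l * t) * (Complex.I * l)) t := by
    have := ((Complex.ofRealCLM.hasDerivAt (x := t)).const_mul (Complex.I * l)).cexp
    simpa using this
  have h2 := (h1.sub_const (Complex.exp (Complex.I * l * s))).div_const (Complex.I * l)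
  have hne : Complex.I * (l : ℂ) ≠ 0 := by simpa using hl
  rwa [mul_div_cancel_right₀ _ hne] at h2

theorem incrementKernel_sub (a s t l : ℝ) :
    incrementKernel a t l - incrementKernel a s l = incrementKernel s t l := by
  unfold incrementKernel; ring

/-- The difference quotients are multipliers bounded by `1` and converge to `exp (i λ t)` for every
`λ ≠ 0`, so dominated convergence applies. -/
theorem hasDerivAt_kernelMul (s t : ℝ) (ψ : FreqL2 r) :
    HasDerivAt (fun t => kernelMul s t ψ) (shift t ψ) t := by
  rw [hasDerivAt_iff_tendsto_slope_zero, tendsto_iff_norm_sub_tendsto_zero,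
    ← tendsto_zero_iff_norm_tendsto_zero]
  refine tendsto_zero_of_multiplier ψ (C := 2)
    (m := fun (h l : ℝ) => (h : ℂ)⁻¹ * incrementKernel t (t + h) l - Complex.exp (Complex.I * l * t))
    ?_ ?_ ?_
  · intro h
    filter_upwards [Lp.coeFn_sub (h⁻¹ • (kernelMul s (t + h) ψ - kernelMul s t ψ)) (shift t ψ),
      Lp.coeFn_smul h⁻¹ (kernelMul s (t + h) ψ - kernelMul s t ψ),
      Lp.coeFn_sub (kernelMul s (t + h) ψ) (kernelMul s t ψ),
      kernelMul_ae s (t + h) ψ, kernelMul_ae s t ψ, shift_ae t ψ] with l h1 h2 h3 h4 h5 h6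
    rw [h1, Pi.sub_apply, h2, Pi.smul_apply, h3, Pi.sub_apply, h4, h5, h6, ← sub_smul,
      incrementKernel_sub, sub_smul, mul_smul, ← Complex.ofReal_inv, Complex.coe_smul]
  · filter_upwards [self_mem_nhdsWithin] with h hh l
    refine (norm_sub_le _ _).trans ?_
    rw [norm_exp_I_mul_mul, norm_mul, norm_inv, Complex.norm_real, Real.norm_eq_abs]
    have h1 := norm_incrementKernel_le t (t + h) l
    rw [add_sub_cancel_left] at h1
    have h2 : 0 < |h| := abs_pos.mpr hh
    have h3 : |h|⁻¹ * ‖incrementKernel t (t + h) l‖ ≤ 1 := by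
      rw [inv_mul_le_iff₀ h2, mul_one]; exact h1
    linarith
  · have h0 : ∀ᵐ ξ : ℝ, ξ ≠ 0 := by simp [ae_iff]
    filter_upwards [h0] with l hl
    have := (hasDerivAt_iff_tendsto_slope_zero.mp (hasDerivAt_incrementKernel s t hl)).sub_const
      (Complex.exp (Complex.I * l * t))
    rw [sub_self] at this
    refine this.congr fun h => ?_
    rw [incrementKernel_sub, ← Complex.ofReal_inv]
    rfl

theorem kernelMul_self (s : ℝ) (ψ : FreqL2 r) : kernelMul s s ψ = 0 := by
  rw [Lp.eq_zero_iff_ae_eq_zero]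
  filter_upwards [kernelMul_ae s s ψ] with l hl
  rw [hl]
  simp [incrementKernel]

/-- The frequency side of the drift integral: integrating a stationary curve over `[s, t]`
multiplies its spectral density by the increment kernel. -/
theorem integral_shift (s t : ℝ) (ψ : FreqL2 r) :
    ∫ τ in s..t, shift τ ψ = kernelMul s t ψ := by
  rw [intervalIntegral.integral_eq_sub_of_hasDerivAt
    (fun τ _ => hasDerivAt_kernelMul s τ ψ) ((continuous_shift ψ).intervalIntegrable _ _),
    kernelMul_self, sub_zero]

end Multiplier

/-! ### Bounded solutions of linear differential equations -/

/-- The curve `exp (-μ t) • v t` is constant. It tends to zero as `t → -∞` or `t → ∞`, according to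
the sign of `μ.re`, because `v` is bounded. -/
theorem eq_zero_of_hasDerivAt_smul_of_bounded {V : Type*} [NormedAddCommGroup V]
    [NormedSpace ℂ V] {μ : ℂ} (hμ : μ.re ≠ 0) {v : ℝ → V}
    (hv : ∀ t, HasDerivAt v (μ • v t) t) {M : ℝ} (hM : ∀ t, ‖v t‖ ≤ M) (t : ℝ) : v t = 0 := by
  have hexp : ∀ t : ℝ, HasDerivAt (fun t : ℝ => Complex.exp (-μ * t))
      (Complex.exp (-μ * t) * -μ) t := by
    intro t
    have := ((Complex.ofRealCLM.hasDerivAt (x := t)).const_mul (-μ)).cexp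
    simpa using this
  have hconst : ∀ t : ℝ, Complex.exp (-μ * t) • v t = v 0 := by
    intro t
    have hd : ∀ t : ℝ, HasDerivAt (fun t : ℝ => Complex.exp (-μ * t) • v t) 0 t := by
      intro t
      have := (hexp t).smul (hv t)
      have h0 : Complex.exp (-μ * t) • μ • v t + (Complex.exp (-μ * t) * -μ) • v t = 0 := by
        rw [smul_smul, ← add_smul]
        simp
      rw [h0] at this
      exact this
    have := is_const_of_deriv_eq_zero (fun t => (hd t).differentiableAt)
      (fun t => (hd t).deriv) t 0
    simpa using this
  have hbound : ∀ t : ℝ, ‖v 0‖ ≤ Real.exp (-μ.re * t) * M := by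
    intro t
    rw [← hconst t, norm_smul, Complex.norm_exp]
    have : (-μ * (t : ℂ)).re = -μ.re * t := by simp
    rw [this]
    gcongr
    exact hM t
  have h0 : v 0 = 0 := by
    rw [← norm_le_zero_iff]
    rcases lt_or_gt_of_ne hμ with h | h
    · have hl : Filter.Tendsto (fun t : ℝ => Real.exp (-μ.re * t) * M) Filter.atBot
          (nhds (0 * M)) :=
        (Real.tendsto_exp_atBot.comp
          (Filter.tendsto_id.const_mul_atBot (by linarith : 0 < -μ.re))).mul_const M
      rw [zero_mul] at hl
      exact ge_of_tendsto' hl hbound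
    · have hl : Filter.Tendsto (fun t : ℝ => Real.exp (-μ.re * t) * M) Filter.atTop
          (nhds (0 * M)) :=
        (Real.tendsto_exp_atBot.comp
          (Filter.tendsto_id.const_mul_atTop_of_neg (by linarith : -μ.re < 0))).mul_const M
      rw [zero_mul] at hl
      exact ge_of_tendsto' hl hbound
  have := hconst t
  rw [h0] at this
  exact (smul_eq_zero.mp this).resolve_left (Complex.exp_ne_zero _)

open Polynomial in
-- By Cayley–Hamilton the product of the factors `A - μ` over the eigenvalues annihilates `u`.
-- Factors are removed one at a time: if `(A - μ) Q u = 0`, then `Q u` is a bounded solution of the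
-- scalar equation `v' = μ v`, so `Q u = 0`. No diagonalization is needed.
theorem eq_zero_of_hasDerivAt_mulVec_of_bounded {n : ℕ} {A : Matrix (Fin n) (Fin n) ℂ}
    (hA : ∀ z ∈ spectrum ℂ A, z.re ≠ 0) {u : ℝ → Fin n → ℂ}
    (hu : ∀ t, HasDerivAt u (A.mulVec (u t)) t) {M : ℝ} (hM : ∀ t, ‖u t‖ ≤ M) (t : ℝ) :
    u t = 0 := by
  have key : ∀ S : Multiset ℂ, (∀ μ ∈ S, μ.re ≠ 0) →
      (∀ t, (aeval A (S.map fun μ => X - C μ).prod).mulVec (u t) = 0) → ∀ t, u t = 0 := by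
    intro S
    induction S using Multiset.induction with
    | empty =>
      intro _ h t
      simpa using h t
    | cons μ S ih =>
      intro hS h
      refine ih (fun z hz => hS z (Multiset.mem_cons_of_mem hz)) fun t => ?_
      set Q := aeval A (S.map fun μ => X - C μ).prod with hQ
      have hcomm : A * Q = Q * A := by
        have h1 : A = aeval A (X : ℂ[X]) := by simp
        conv_lhs => rw [h1, hQ, ← map_mul, mul_comm, map_mul, ← h1]
      set L : (Fin n → ℂ) →L[ℝ] (Fin n → ℂ) :=
        (LinearMap.toContinuousLinearMap (Matrix.mulVecLin Q)).restrictScalars ℝ with hL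
      have hLa : ∀ y, L y = Q.mulVec y := fun y => rfl
      refine eq_zero_of_hasDerivAt_smul_of_bounded (v := fun t => Q.mulVec (u t))
        (hS μ (Multiset.mem_cons_self μ S)) (fun t => ?_) (M := ‖L‖ * M) (fun t => ?_) t
      · have h1 : HasDerivAt (fun t => L (u t)) (L (A.mulVec (u t))) t :=
          L.hasFDerivAt.comp_hasDerivAt t (hu t)
        have h2 : L (A.mulVec (u t)) = μ • Q.mulVec (u t) := by
          have h3 := h t
          rw [Multiset.map_cons, Multiset.prod_cons, map_mul, map_sub, aeval_X, aeval_C, ← hQ,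
            sub_mul, Matrix.sub_mulVec, sub_eq_zero, hcomm, ← Matrix.mulVec_mulVec] at h3
          rw [hLa, h3, Algebra.algebraMap_eq_smul_one, smul_mul_assoc, one_mul,
            Matrix.smul_mulVec]
        rw [h2] at h1
        exact h1
      · rw [← hLa]
        exact (L.le_opNorm _).trans (by gcongr; exact hM t)
  refine key A.charpoly.roots (fun μ hμ => hA μ ?_) (fun t => ?_) t
  · exact Matrix.mem_spectrum_iff_isRoot_charpoly.mpr (isRoot_of_mem_roots hμ)
  · rw [← (IsAlgClosed.splits A.charpoly).eq_prod_roots_of_monic A.charpoly_monic,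
      Matrix.aeval_self_charpoly, Matrix.zero_mulVec]

/-- A bounded curve with `dz = A z dt`, where `A` has no imaginary eigenvalues, vanishes. -/
theorem eq_zero_of_integral_eq_of_bounded {n : ℕ} {H : Type*} [NormedAddCommGroup H]
    [InnerProductSpace ℂ H] [CompleteSpace H] {A : Matrix (Fin n) (Fin n) ℂ}
    (hA : ∀ z ∈ spectrum ℂ A, z.re ≠ 0) {z : ℝ → Fin n → H}
    (hc : ∀ i, Continuous fun t => z t i)
    (hz : ∀ s t i, z t i - z s i = ∫ τ in s..t, ∑ j, A i j • z τ j)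
    {M : ℝ} (hM : ∀ t i, ‖z t i‖ ≤ M) (t : ℝ) (i : Fin n) : z t i = 0 := by
  have hd : ∀ t i, HasDerivAt (fun t => z t i) (∑ j, A i j • z t j) t := by
    intro t i
    have hcont : Continuous fun τ => ∑ j, A i j • z τ j :=
      continuous_finsetSum _ fun j _ => (hc j).const_smul _
    have h1 := (hcont.integral_hasStrictDerivAt 0 t).hasDerivAt
    have h2 : (fun t => z t i) = fun t => (∫ τ in (0 : ℝ)..t, ∑ j, A i j • z τ j) + z 0 i := by
      funext t
      rw [← hz, sub_add_cancel]
    rw [h2]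
    exact h1.add_const _
  -- Pairing with a fixed `h` turns the equation in `H` into one in `ℂⁿ`.
  have hinner : ∀ h : H, inner ℂ h (z t i) = 0 := by
    intro h
    have := eq_zero_of_hasDerivAt_mulVec_of_bounded hA
      (u := fun t i => inner ℂ h (z t i)) (M := ‖h‖ * max M 0) (fun t => ?_) (fun t => ?_) t
    · exact congrFun this i
    · rw [hasDerivAt_pi]
      intro i
      have h1 := ((innerSL ℂ h).restrictScalars ℝ).hasFDerivAt.comp_hasDerivAt t (hd t i)
      have h2 : inner ℂ h (∑ j, A i j • z t j) =
          A.mulVec (fun i => inner ℂ h (z t i)) i := by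
        simp only [Matrix.mulVec, dotProduct, inner_sum, inner_smul_right]
      rw [← h2]
      exact h1
    · refine (pi_norm_le_iff_of_nonneg (by positivity)).mpr fun i => ?_
      refine (norm_inner_le_norm _ _).trans ?_
      gcongr
      exact (hM t i).trans (le_max_left _ _)
  exact inner_self_eq_zero.mp (hinner (z t i))

/-! ### Rational matrix functions -/

/-! ### Regularity and decay of the resolvent -/

section Resolvent

open scoped Matrix.Norms.Operator

variable {n : ℕ} (A : Matrix (Fin n) (Fin n) ℂ)

theorem norm_entry_le_linfty_opNorm {m n : ℕ} (A : Matrix (Fin m) (Fin n) ℂ) (i : Fin m)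
    (j : Fin n) : ‖A i j‖ ≤ ‖A‖ := by
  rw [Matrix.linfty_opNorm_def, ← coe_nnnorm, NNReal.coe_le_coe]
  exact (Finset.single_le_sum (f := fun j => ‖A i j‖₊) (fun _ _ => zero_le) (Finset.mem_univ j)).trans
    (Finset.le_sup (f := fun i => ∑ j, ‖A i j‖₊) (Finset.mem_univ i))

theorem inv_smul_one_sub_eq_resolvent (s : ℂ) :
    (s • (1 : Matrix (Fin n) (Fin n) ℂ) - A)⁻¹ = resolvent A s := by
  rw [Matrix.nonsing_inv_eq_ringInverse, resolvent, Algebra.algebraMap_eq_smul_one]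

theorem differentiableAt_resolvent_entry {s : ℂ} (hs : s ∉ spectrum ℂ A) (i j : Fin n) :
    DifferentiableAt ℂ (fun s : ℂ => (s • (1 : Matrix (Fin n) (Fin n) ℂ) - A)⁻¹ i j) s := by
  simp_rw [inv_smul_one_sub_eq_resolvent]
  have h := (spectrum.hasDerivAt_resolvent_const_left (𝕜 := ℂ) (a := A) (k := s)
    (by simpa [spectrum] using hs)).differentiableAt
  exact (LinearMap.toContinuousLinearMap (Matrix.entryLinearMap ℂ ℂ i j)).differentiableAt.comp s h

/-- On a closed set without eigenvalues the resolvent is bounded and decays at infinity. -/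
theorem exists_resolvent_entry_bound {S : Set ℂ} (hS : IsClosed S)
    (hd : ∀ s ∈ S, s ∉ spectrum ℂ A) :
    ∃ M : ℝ, ∀ s ∈ S, ∀ i j,
      ‖(s • (1 : Matrix (Fin n) (Fin n) ℂ) - A)⁻¹ i j‖ ≤ M * (1 + ‖s‖)⁻¹ := by
  obtain ⟨C, hC⟩ := (spectrum.resolvent_isBigO_inv (𝕜 := ℂ) A).bound
  rw [(Metric.hasBasis_cobounded_compl_closedBall (0 : ℂ)).eventually_iff] at hC
  obtain ⟨ρ, -, hρ⟩ := hC
  set R := max ρ 1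
  have hcont : ContinuousOn (fun s => resolvent A s) (S ∩ Metric.closedBall 0 R) := by
    intro s hs
    exact (spectrum.hasDerivAt_resolvent_const_left (𝕜 := ℂ) (a := A) (k := s)
      (by simpa [spectrum] using hd s hs.1)).continuousAt.continuousWithinAt
  obtain ⟨M₀, hM₀⟩ := (((isCompact_closedBall (0 : ℂ) R).inter_left hS).exists_bound_of_continuousOn
    hcont)
  -- Inside the ball, compactness gives the bound `M₀` and `1 + ‖s‖ ≤ 1 + R`; outside, the decay is
  -- `C / ‖s‖` and `1 + ‖s‖ ≤ 2 ‖s‖` since `R ≥ 1`.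
  refine ⟨max (M₀ * (1 + R)) (2 * C), fun s hs i j => ?_⟩
  have hpos : 0 < 1 + ‖s‖ := by positivity
  rw [inv_smul_one_sub_eq_resolvent, ← div_eq_mul_inv, le_div_iff₀ hpos]
  refine (mul_le_mul_of_nonneg_right (norm_entry_le_linfty_opNorm _ i j) hpos.le).trans ?_
  by_cases h : ‖s‖ ≤ R
  · have h1 := hM₀ s ⟨hs, by simpa using h⟩
    have h2 : 0 ≤ M₀ := (norm_nonneg _).trans h1
    exact (mul_le_mul h1 (by linarith) hpos.le h2).trans (le_max_left _ _)
  · have h := not_le.mp h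
    have h1 := hρ (show s ∈ (Metric.closedBall 0 ρ)ᶜ by
      simpa using (le_max_left ρ 1).trans_lt h)
    have h3 : 1 < ‖s‖ := (le_max_right ρ 1).trans_lt h
    rw [norm_inv] at h1
    have hC0 : 0 ≤ C := by
      by_contra hneg
      have : C * ‖s‖⁻¹ < 0 := mul_neg_of_neg_of_pos (not_le.mp hneg) (by positivity)
      linarith [norm_nonneg (resolvent A s)]
    refine le_trans ?_ (le_max_right _ _)
    calc ‖resolvent A s‖ * (1 + ‖s‖) ≤ (C * ‖s‖⁻¹) * (‖s‖ + ‖s‖) := by gcongr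
      _ = 2 * C := by field_simp; ring

end Resolvent

/-! ### Regularity and bounds of transfer functions -/

section Transfer

variable {m n r : ℕ} (C : Matrix (Fin m) (Fin n) ℝ) (F : Matrix (Fin n) (Fin n) ℝ)
  (G : Matrix (Fin n) (Fin r) ℝ) (D : Matrix (Fin m) (Fin r) ℝ)

/-- The state part `(s I - F)⁻¹ G` of a transfer function. -/
noncomputable def stateTransfer (s : ℂ) : Matrix (Fin n) (Fin r) ℂ :=
  (s • (1 : Matrix (Fin n) (Fin n) ℂ) - F.map Complex.ofReal)⁻¹ * G.map Complex.ofReal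

theorem transfer_eq (s : ℂ) :
    transfer C F G D s = C.map Complex.ofReal * stateTransfer F G s + D.map Complex.ofReal := by
  rw [transfer, stateTransfer, Matrix.mul_assoc]

theorem transfer_apply (s : ℂ) (i : Fin m) (k : Fin r) :
    transfer C F G D s i k = ∑ j, (C i j : ℂ) * stateTransfer F G s j k + (D i k : ℂ) := by
  rw [transfer_eq, Matrix.add_apply, Matrix.mul_apply]
  rfl

theorem differentiableAt_stateTransfer {s : ℂ} (hs : s ∉ spectrum ℂ (F.map Complex.ofReal))
    (i : Fin n) (k : Fin r) : DifferentiableAt ℂ (fun s => stateTransfer F G s i k) s := by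
  simp only [stateTransfer, Matrix.mul_apply]
  exact DifferentiableAt.fun_sum fun j _ => (differentiableAt_resolvent_entry _ hs i j).mul_const _

theorem differentiableAt_transfer {s : ℂ} (hs : s ∉ spectrum ℂ (F.map Complex.ofReal))
    (i : Fin m) (k : Fin r) : DifferentiableAt ℂ (fun s => transfer C F G D s i k) s := by
  simp only [transfer_apply]
  exact (DifferentiableAt.fun_sum fun j _ =>
    (differentiableAt_stateTransfer F G hs j k).const_mul _).add_const _

variable {S : Set ℂ} (hS : IsClosed S) (hd : ∀ s ∈ S, s ∉ spectrum ℂ (F.map Complex.ofReal))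
include hS hd

theorem exists_stateTransfer_bound :
    ∃ M : ℝ, 0 ≤ M ∧ ∀ s ∈ S, ∀ i k, ‖stateTransfer F G s i k‖ ≤ M * (1 + ‖s‖)⁻¹ := by
  obtain ⟨M, hM⟩ := exists_resolvent_entry_bound (F.map Complex.ofReal) hS hd
  refine ⟨∑ i, ∑ j, |M| * |G i j|, by positivity, fun s hs i k => ?_⟩
  simp only [stateTransfer, Matrix.mul_apply]
  refine (norm_sum_le _ _).trans ?_
  rw [Finset.sum_mul]
  refine Finset.sum_le_sum fun j _ => ?_
  rw [norm_mul, Matrix.map_apply, Complex.norm_real, Real.norm_eq_abs]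
  calc _ ≤ (|M| * (1 + ‖s‖)⁻¹) * |G j k| := by
        gcongr
        exact (hM s hs i j).trans (by gcongr; exact le_abs_self M)
    _ = |M| * |G j k| * (1 + ‖s‖)⁻¹ := by ring
    _ ≤ _ := by
        gcongr
        exact Finset.single_le_sum (f := fun k => |M| * |G j k|) (fun _ _ => by positivity)
          (Finset.mem_univ k)

theorem exists_transfer_bound : ∃ M : ℝ, ∀ s ∈ S, ∀ i k, ‖transfer C F G D s i k‖ ≤ M := by
  obtain ⟨M, hM0, hM⟩ := exists_stateTransfer_bound F G hS hd
  refine ⟨∑ i, ∑ j, |C i j| * M + ∑ i, ∑ k, |D i k|, fun s hs i k => ?_⟩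
  rw [transfer_apply]
  refine (norm_add_le _ _).trans (add_le_add ((norm_sum_le _ _).trans ?_) ?_)
  · refine le_trans (Finset.sum_le_sum fun j _ => ?_) (Finset.single_le_sum
      (f := fun i => ∑ j, |C i j| * M) (fun _ _ => by positivity) (Finset.mem_univ i))
    rw [norm_mul, Complex.norm_real, Real.norm_eq_abs]
    gcongr
    refine (hM s hs j k).trans (mul_le_of_le_one_right hM0 ?_)
    exact inv_le_one_of_one_le₀ (by linarith [norm_nonneg s])
  · rw [Complex.norm_real, Real.norm_eq_abs]
    exact (Finset.single_le_sum (f := fun k => |D i k|) (fun _ _ => abs_nonneg _)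
      (Finset.mem_univ k)).trans (Finset.single_le_sum (f := fun i => ∑ k, |D i k|)
      (fun _ _ => by positivity) (Finset.mem_univ i))

end Transfer

/-! ### Polynomial numerators and continuation from the imaginary axis -/

section Polynomials

open Polynomial

variable {m n r : ℕ} (C : Matrix (Fin m) (Fin n) ℝ) (F : Matrix (Fin n) (Fin n) ℝ)
  (G : Matrix (Fin n) (Fin r) ℝ) (D : Matrix (Fin m) (Fin r) ℝ)

theorem map_charmatrix (s : ℂ) :
    (aeval s : ℝ[X] →ₐ[ℝ] ℂ).mapMatrix (Matrix.charmatrix F) =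
      s • (1 : Matrix (Fin n) (Fin n) ℂ) - F.map Complex.ofReal := by
  ext i j
  rcases eq_or_ne i j with rfl | hij
  · simp
  · simp [hij]

theorem aeval_charpoly (s : ℂ) :
    aeval s F.charpoly = (s • (1 : Matrix (Fin n) (Fin n) ℂ) - F.map Complex.ofReal).det := by
  rw [Matrix.charpoly, AlgHom.map_det, map_charmatrix]

theorem aeval_charpoly_ne_zero_iff {s : ℂ} :
    aeval s F.charpoly ≠ 0 ↔ s ∉ spectrum ℂ (F.map Complex.ofReal) := by
  rw [aeval_charpoly, spectrum.notMem_iff, Algebra.algebraMap_eq_smul_one,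
    Matrix.isUnit_iff_isUnit_det, isUnit_iff_ne_zero]

/-- Numerator of the transfer function over the characteristic polynomial of `F`. -/
noncomputable def transferNum : Matrix (Fin m) (Fin r) ℝ[X] :=
  C.map Polynomial.C * (Matrix.charmatrix F).adjugate * G.map Polynomial.C
    + F.charpoly • D.map Polynomial.C

theorem map_aeval_transferNum {s : ℂ} (hs : s ∉ spectrum ℂ (F.map Complex.ofReal)) :
    (transferNum C F G D).map (aeval s) = aeval s F.charpoly • transfer C F G D s := by
  have hs' := (aeval_charpoly_ne_zero_iff F).mpr hs
  have hadj : (Matrix.charmatrix F).adjugate.map (aeval s) =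
      (s • (1 : Matrix (Fin n) (Fin n) ℂ) - F.map Complex.ofReal).adjugate := by
    rw [← map_charmatrix, ← AlgHom.map_adjugate]
    rfl
  have hC : ∀ {a b : ℕ} (M : Matrix (Fin a) (Fin b) ℝ),
      (M.map Polynomial.C).map (aeval s) = M.map Complex.ofReal := by
    intro a b M
    ext i j
    simp
  have hmul : ∀ {a b c : ℕ} (M : Matrix (Fin a) (Fin b) ℝ[X]) (N : Matrix (Fin b) (Fin c) ℝ[X]),
      (M * N).map (aeval s) = M.map (aeval s) * N.map (aeval s) := by
    intro a b c M N
    ext i j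
    simp [Matrix.mul_apply]
  have hinv : (s • (1 : Matrix (Fin n) (Fin n) ℂ) - F.map Complex.ofReal).adjugate =
      aeval s F.charpoly • (s • (1 : Matrix (Fin n) (Fin n) ℂ) - F.map Complex.ofReal)⁻¹ := by
    rw [Matrix.inv_def, ← aeval_charpoly, Ring.inverse_eq_inv', smul_smul, mul_inv_cancel₀ hs',
      one_smul]
  have hadd : (transferNum C F G D).map (aeval s) =
      (C.map Polynomial.C * (Matrix.charmatrix F).adjugate * G.map Polynomial.C).map (aeval s)
        + aeval s F.charpoly • (D.map Polynomial.C).map (aeval s) := by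
    ext i j
    simp only [transferNum, Matrix.map_apply, Matrix.add_apply, Matrix.smul_apply, smul_eq_mul,
      map_add, map_mul]
  rw [hadd, hmul, hmul, hC, hC, hC, hadj, hinv, transfer, smul_add, Matrix.mul_smul,
    Matrix.smul_mul]

theorem transfer_apply_eq_div {s : ℂ} (hs : s ∉ spectrum ℂ (F.map Complex.ofReal))
    (i : Fin m) (k : Fin r) :
    transfer C F G D s i k = aeval s (transferNum C F G D i k) / aeval s F.charpoly := by
  have h := congrFun (congrFun (map_aeval_transferNum C F G D hs) i) k
  rw [Matrix.map_apply, Matrix.smul_apply, smul_eq_mul] at h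
  rw [h, mul_div_cancel_left₀ _ ((aeval_charpoly_ne_zero_iff F).mpr hs)]

theorem aeval_det_transferNum (C : Matrix (Fin r) (Fin n) ℝ) (D : Matrix (Fin r) (Fin r) ℝ)
    {s : ℂ} (hs : s ∉ spectrum ℂ (F.map Complex.ofReal)) :
    aeval s (transferNum C F G D).det =
      aeval s F.charpoly ^ r * (transfer C F G D s).det := by
  rw [AlgHom.map_det, AlgHom.mapMatrix_apply, map_aeval_transferNum C F G D hs, Matrix.det_smul,
    Fintype.card_fin]

theorem finite_imaginary_zeros {p : ℝ[X]} (hp : p ≠ 0) :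
    {l : ℝ | aeval (Complex.I * l) p = 0}.Finite := by
  have hinj : Function.Injective fun l : ℝ => Complex.I * (l : ℂ) := by
    intro a b h
    simpa using h
  refine ((p.aroots ℂ).toFinset.finite_toSet.preimage hinj.injOn).subset fun l hl => ?_
  simpa [mem_aroots, hp] using hl

/-- A nonzero polynomial has finitely many zeros on the axis. This is what carries almost-everywhere
relations over to the whole plane. -/
theorem eq_zero_of_ae_imaginary {p : ℝ[X]} (h : ∀ᵐ l : ℝ, aeval (Complex.I * l) p = 0) :
    p = 0 := by
  by_contra hp
  have h2 : ∀ᵐ l : ℝ, aeval (Complex.I * l) p ≠ 0 := by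
    rw [ae_iff]
    simpa using (finite_imaginary_zeros hp).measure_zero volume
  obtain ⟨l, h3, h4⟩ := (h.and h2).exists
  exact h4 h3

variable {F} {F' : Matrix (Fin n) (Fin n) ℝ} {G} {G' : Matrix (Fin n) (Fin r) ℝ}
  {C C' L : Matrix (Fin r) (Fin n) ℝ} {D D' E : Matrix (Fin r) (Fin r) ℝ}
  (hF : ∀ l : ℝ, Complex.I * l ∉ spectrum ℂ (F.map Complex.ofReal))
  (hF' : ∀ l : ℝ, Complex.I * l ∉ spectrum ℂ (F'.map Complex.ofReal))
  (h : ∀ᵐ l : ℝ, transfer C F G D (Complex.I * l) =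
    transfer C' F' G' D' (Complex.I * l) * transfer L F G E (Complex.I * l))
include hF hF' h

/-- Clearing the denominators of the factorization, where one factor `F.charpoly` cancels, leaves a
polynomial relation that holds almost everywhere on the axis. -/
theorem transferNum_eq_of_ae :
    F'.charpoly • transferNum C F G D = transferNum C' F' G' D' * transferNum L F G E := by
  ext1 i j
  rw [← sub_eq_zero]
  refine eq_zero_of_ae_imaginary ?_
  filter_upwards [h] with l hl
  have h1 := map_aeval_transferNum C F G D (hF l)
  have h2 := map_aeval_transferNum C' F' G' D' (hF' l)
  have h3 := map_aeval_transferNum L F G E (hF l)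
  have e1 := congrFun (congrFun h1 i) j
  have e2 := fun k => congrFun (congrFun h2 i) k
  have e3 := fun k => congrFun (congrFun h3 k) j
  simp only [Matrix.map_apply, Matrix.smul_apply, smul_eq_mul] at e1 e2 e3
  rw [map_sub, Matrix.smul_apply, Matrix.mul_apply, smul_eq_mul, map_mul, map_sum, e1, hl,
    Matrix.mul_apply, Finset.mul_sum, Finset.mul_sum, ← Finset.sum_sub_distrib]
  refine Finset.sum_eq_zero fun k _ => ?_
  rw [map_mul, e2, e3]
  ring

/-- A factorization on the imaginary axis extends to all regular points. -/
theorem transfer_eq_mul_of_ae {s : ℂ} (hs : s ∉ spectrum ℂ (F.map Complex.ofReal))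
    (hs' : s ∉ spectrum ℂ (F'.map Complex.ofReal)) :
    transfer C F G D s = transfer C' F' G' D' s * transfer L F G E s := by
  have h0 := transferNum_eq_of_ae hF hF' h
  ext i j
  have h1 := congrArg (aeval s) (congrFun (congrFun h0 i) j)
  have e1 := congrFun (congrFun (map_aeval_transferNum C F G D hs) i) j
  have e2 := fun k => congrFun (congrFun (map_aeval_transferNum C' F' G' D' hs') i) k
  have e3 := fun k => congrFun (congrFun (map_aeval_transferNum L F G E hs) k) j
  simp only [Matrix.map_apply, Matrix.smul_apply, smul_eq_mul] at e1 e2 e3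
  rw [Matrix.smul_apply, Matrix.mul_apply, smul_eq_mul, map_mul, map_sum, e1] at h1
  simp only [map_mul, e2, e3] at h1
  have hne := (aeval_charpoly_ne_zero_iff F).mpr hs
  have hne' := (aeval_charpoly_ne_zero_iff F').mpr hs'
  refine mul_left_cancel₀ (mul_ne_zero hne' hne) ?_
  rw [mul_assoc, h1, Matrix.mul_apply, Finset.mul_sum]
  exact Finset.sum_congr rfl fun k _ => by ring

/-- Take determinants in the polynomial identity: the left side is nonzero because `F'.charpoly` is
monic and the first transfer function is invertible, so neither factor on the right vanishes. -/
theorem det_transferNum_ne_zero (hinv : TransferInvertible C F G D) :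
    (transferNum C' F' G' D').det ≠ 0 := by
  obtain ⟨s, hs, hdet⟩ := hinv
  have h1 : (transferNum C F G D).det ≠ 0 := by
    intro h0
    have := aeval_det_transferNum F G C D hs
    rw [h0, map_zero] at this
    exact mul_ne_zero (pow_ne_zero _ ((aeval_charpoly_ne_zero_iff F).mpr hs)) hdet this.symm
  have h2 := congrArg Matrix.det (transferNum_eq_of_ae hF hF' h)
  rw [Matrix.det_smul, Matrix.det_mul] at h2
  intro h0
  rw [h0, zero_mul] at h2
  exact mul_ne_zero (pow_ne_zero _ F'.charpoly_monic.ne_zero) h1 h2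

theorem finite_det_transfer_eq_zero (hinv : TransferInvertible C F G D) :
    {l : ℝ | (transfer C' F' G' D' (Complex.I * l)).det = 0}.Finite := by
  refine (finite_imaginary_zeros (det_transferNum_ne_zero hF hF' h hinv)).subset fun l hl => ?_
  rw [Set.mem_ofPred_eq] at hl ⊢
  rw [aeval_det_transferNum F' G' C' D' (hF' l), hl, mul_zero]

theorem transferInvertible_of_ae (hinv : TransferInvertible C F G D) :
    TransferInvertible C' F' G' D' := by
  obtain ⟨l, hl⟩ := (finite_det_transfer_eq_zero hF hF' h hinv).exists_notMem
  exact ⟨Complex.I * l, hF' l, hl⟩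

end Polynomials

/-! ### Spectral representation of the state and of linear outputs -/

theorem I_mul_ofReal_notMem_spectrum {n : ℕ} {A : Matrix (Fin n) (Fin n) ℂ}
    (hA : ∀ z ∈ spectrum ℂ A, z.re ≠ 0) (l : ℝ) : Complex.I * l ∉ spectrum ℂ A := by
  intro h
  exact hA _ h (by simp)

theorem freqL2_coeFn_sum {r : ℕ} {ι : Type*} (S : Finset ι) (f : ι → FreqL2 r) :
    ((∑ i ∈ S, f i : FreqL2 r) : ℝ → EuclideanSpace ℂ (Fin r)) =ᵐ[freqMeasure]
      ∑ i ∈ S, (f i : ℝ → EuclideanSpace ℂ (Fin r)) := by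
  classical
  induction S using Finset.induction_on with
  | empty => simpa using Lp.coeFn_zero (EuclideanSpace ℂ (Fin r)) 2 freqMeasure
  | insert a S ha ih =>
    rw [Finset.sum_insert ha, Finset.sum_insert ha]
    filter_upwards [Lp.coeFn_add (f a) (∑ i ∈ S, f i), ih] with l h1 h2
    rw [h1, Pi.add_apply, h2, Pi.add_apply]

section StateRow

variable {n r : ℕ} {F : Matrix (Fin n) (Fin n) ℝ}
  (hF : ∀ z ∈ spectrum ℂ (F.map Complex.ofReal), z.re ≠ 0) (G : Matrix (Fin n) (Fin r) ℝ)
include hF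

theorem continuous_stateTransfer_axis (i : Fin n) (k : Fin r) :
    Continuous fun l : ℝ => stateTransfer F G (Complex.I * l) i k := by
  rw [continuous_iff_continuousAt]
  intro l
  have h := (differentiableAt_stateTransfer F G (I_mul_ofReal_notMem_spectrum hF l) i k).continuousAt
  have h2 : Continuous fun l : ℝ => Complex.I * (l : ℂ) := by fun_prop
  exact ContinuousAt.comp (f := fun l : ℝ => Complex.I * (l : ℂ)) h h2.continuousAt

/-- On the axis, which is free of eigenvalues, the entries are at most `M / (1 + |λ|)`, so their
squares are dominated by a multiple of `1 / (1 + λ²)`. -/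
theorem memLp_stateRow (i : Fin n) :
    MemLp (fun l : ℝ => (WithLp.toLp 2 fun k => stateTransfer F G (Complex.I * l) i k :
      EuclideanSpace ℂ (Fin r))) 2 freqMeasure := by
  have hcont : Continuous fun l : ℝ =>
      (WithLp.toLp 2 fun k => stateTransfer F G (Complex.I * l) i k :
        EuclideanSpace ℂ (Fin r)) :=
    (PiLp.continuous_toLp 2 _).comp
      (continuous_pi fun k => continuous_stateTransfer_axis hF G i k)
  rw [memLp_two_iff_integrable_sq_norm hcont.aestronglyMeasurable]
  obtain ⟨M, hM0, hM⟩ := exists_stateTransfer_bound F G (S := {s : ℂ | s.re = 0})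
    (isClosed_eq Complex.continuous_re continuous_const) (fun s hs h => hF s h hs)
  have hint : Integrable (fun l : ℝ => (r : ℝ) * M ^ 2 * (1 + l ^ 2)⁻¹) freqMeasure :=
    (integrable_inv_one_add_sq.const_mul _).smul_measure ENNReal.ofReal_ne_top
  refine hint.mono' (hcont.norm.pow 2).aestronglyMeasurable
    (Filter.Eventually.of_forall fun l => ?_)
  rw [Real.norm_of_nonneg (by positivity), EuclideanSpace.norm_sq_eq]
  have hk : ∀ k ∈ (Finset.univ : Finset (Fin r)),
      ‖stateTransfer F G (Complex.I * l) i k‖ ^ 2 ≤ M ^ 2 * (1 + l ^ 2)⁻¹ := by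
    intro k _
    have h1 := hM (Complex.I * l) (by simp) i k
    have h2 : ‖Complex.I * (l : ℂ)‖ = |l| := by simp
    rw [h2] at h1
    calc _ ≤ (M * (1 + |l|)⁻¹) ^ 2 := by gcongr
      _ = M ^ 2 * ((1 + |l|) ^ 2)⁻¹ := by rw [mul_pow, inv_pow]
      _ ≤ _ := by
        gcongr
        nlinarith [abs_nonneg l, sq_abs l]
  calc _ ≤ ∑ _k : Fin r, M ^ 2 * (1 + l ^ 2)⁻¹ := Finset.sum_le_sum hk
    _ = _ := by simp [mul_assoc]

/-- The `i`-th row of `(i λ - F)⁻¹ G`, as an element of `L²`. -/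
noncomputable def stateRow (i : Fin n) : FreqL2 r := (memLp_stateRow hF G i).toLp _

theorem stateRow_ae (i : Fin n) : ∀ᵐ l ∂freqMeasure, ∀ k,
    stateRow hF G i l k = stateTransfer F G (Complex.I * l) i k := by
  filter_upwards [(memLp_stateRow hF G i).coeFn_toLp] with l hl k
  rw [stateRow, hl]

variable {m : ℕ} (C : Matrix (Fin m) (Fin n) ℝ) (D : Matrix (Fin m) (Fin r) ℝ)

/-- The increment kernel times the `i`-th row of the transfer function. -/
noncomputable def outputRow (s t : ℝ) (i : Fin m) : FreqL2 r :=
  ∑ j, (C i j : ℂ) • kernelMul s t (stateRow hF G j) + ∑ k, (D i k : ℂ) • kernelL2 s t k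

theorem outputRow_ae (s t : ℝ) (i : Fin m) : ∀ᵐ l ∂freqMeasure, ∀ k,
    outputRow hF G C D s t i l k =
      incrementKernel s t l * transfer C F G D (Complex.I * l) i k := by
  have h1 := Lp.coeFn_add (∑ j, (C i j : ℂ) • kernelMul s t (stateRow hF G j))
    (∑ k, (D i k : ℂ) • kernelL2 s t k)
  have h2 := freqL2_coeFn_sum Finset.univ fun j => (C i j : ℂ) • kernelMul s t (stateRow hF G j)
  have h3 := freqL2_coeFn_sum Finset.univ fun k => (D i k : ℂ) • (kernelL2 s t k : FreqL2 r)
  have h4 := ae_all_iff.mpr fun j =>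
    Lp.coeFn_smul (C i j : ℂ) (kernelMul s t (stateRow hF G j))
  have h5 := ae_all_iff.mpr fun k => Lp.coeFn_smul (D i k : ℂ) (kernelL2 s t k : FreqL2 r)
  have h6 := ae_all_iff.mpr fun j => kernelMul_ae s t (stateRow hF G j)
  have h7 := ae_all_iff.mpr fun j => stateRow_ae hF G j
  have h8 := ae_all_iff.mpr fun k : Fin r => kernelL2_ae s t k
  filter_upwards [h1, h2, h3, h4, h5, h6, h7, h8] with l h1 h2 h3 h4 h5 h6 h7 h8 k
  rw [outputRow, h1, Pi.add_apply, h2, h3, Finset.sum_apply, Finset.sum_apply, transfer_apply,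
    mul_add, Finset.mul_sum]
  simp only [h4, h5, Pi.smul_apply, h6, h8, PiLp.add_apply, WithLp.ofLp_sum, Finset.sum_apply,
    PiLp.smul_apply, h7, smul_eq_mul, PiLp.single_apply, mul_ite, mul_zero,
    Finset.sum_ite_eq, Finset.mem_univ, if_true]
  congr 1
  · exact Finset.sum_congr rfl fun j _ => by ring
  · ring

omit hF in
-- This is `F (s - F)⁻¹ + 1 = s (s - F)⁻¹`: at `s = i λ` the factor `s` cancels the denominator of
-- the increment kernel.
theorem transfer_state {s : ℂ} (hs : s ∉ spectrum ℂ (F.map Complex.ofReal)) :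
    transfer F F G G s = s • stateTransfer F G s := by
  have hu : IsUnit (s • (1 : Matrix (Fin n) (Fin n) ℂ) - F.map Complex.ofReal).det := by
    rw [← Matrix.isUnit_iff_isUnit_det, ← Algebra.algebraMap_eq_smul_one]
    exact spectrum.notMem_iff.mp hs
  have h := Matrix.mul_nonsing_inv _ hu
  rw [sub_mul, smul_mul_assoc, one_mul, sub_eq_iff_eq_add] at h
  rw [transfer_eq, stateTransfer, ← Matrix.mul_assoc, ← Matrix.smul_mul, h, Matrix.add_mul,
    Matrix.one_mul, add_comm]

/-- The shifted rows of `(i λ - F)⁻¹ G` solve the state equation in the frequency domain. -/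
theorem shift_stateRow_sub (s t : ℝ) (i : Fin n) :
    shift t (stateRow hF G i) - shift s (stateRow hF G i) = outputRow hF G F G s t i := by
  refine Lp.ext ?_
  filter_upwards [Lp.coeFn_sub (shift t (stateRow hF G i)) (shift s (stateRow hF G i)),
    shift_ae t (stateRow hF G i), shift_ae s (stateRow hF G i), stateRow_ae hF G i,
    outputRow_ae hF G F G s t i] with l h1 h2 h3 h4 h5
  rw [h1, Pi.sub_apply, h2, h3, ← sub_smul, ← incrementKernel_mul]
  ext k
  rw [h5, transfer_state G (I_mul_ofReal_notMem_spectrum hF l)]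
  simp only [PiLp.smul_apply, smul_eq_mul, h4, Matrix.smul_apply]
  ring

end StateRow

/-! ### Transport of the spectral representation to the stochastic Hilbert space -/

section Representation

variable {Ω : Type*} [MeasurableSpace Ω] {P : Measure Ω} {m n r : ℕ}
  {x : L2Curve P (Fin n)} {w : L2Curve P (Fin r)} {F : Matrix (Fin n) (Fin n) ℝ}
  {G : Matrix (Fin n) (Fin r) ℝ} {J : FreqL2 r →ₗᵢ[ℂ] Lp ℂ 2 P}

theorem HasDifferential.complexify_sub {η : L2Curve P (Fin m)} {C : Matrix (Fin m) (Fin n) ℝ}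
    {D : Matrix (Fin m) (Fin r) ℝ} (h : HasDifferential η x w C D)
    (hx : ∀ i, Continuous fun t => x t i) (hJ : IsFourierTransform w J) (s t : ℝ) (i : Fin m) :
    complexify P (η t i - η s i) =
      ∑ j, (C i j : ℂ) • (∫ τ in s..t, complexify P (x τ j)) +
        ∑ k, (D i k : ℂ) • J (kernelL2 s t k) := by
  rw [h s t i, map_add, map_sum]
  congr 1
  · rw [intervalIntegral.integral_finsetSum
      (f := fun j τ => C i j • x τ j) (fun j _ => ((hx j).const_smul (C i j)).intervalIntegrable _ _), map_sum]
    refine Finset.sum_congr rfl fun j _ => ?_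
    rw [intervalIntegral.integral_smul, complexify_smul,
      ContinuousLinearMap.intervalIntegral_comp_comm _ ((hx j).intervalIntegrable _ _)]
  · refine Finset.sum_congr rfl fun k _ => ?_
    rw [complexify_smul, isFourierTransform_iff.mp hJ]

theorem IsWideSenseStationary.norm_eq (hx : IsWideSenseStationary x) (t : ℝ) (i : Fin n) :
    ‖x t i‖ = ‖x 0 i‖ := by
  have h := hx.covariance t 0 0 i i
  rw [zero_add, real_inner_self_eq_norm_sq, real_inner_self_eq_norm_sq] at h
  exact (sq_eq_sq₀ (norm_nonneg _) (norm_nonneg _)).mp h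

theorem integral_isometry_shift (J : FreqL2 r →ₗᵢ[ℂ] Lp ℂ 2 P) (s t : ℝ) (ψ : FreqL2 r) :
    ∫ τ in s..t, J (shift τ ψ) = J (kernelMul s t ψ) := by
  rw [← integral_shift]
  exact J.toContinuousLinearMap.intervalIntegral_comp_comm
    ((continuous_shift ψ).intervalIntegrable _ _)

variable (hF : ∀ z ∈ spectrum ℂ (F.map Complex.ofReal), z.re ≠ 0)
  (hx : IsWideSenseStationary x) (hJ : IsFourierTransform w J) (hdyn : HasDifferential x x w F G)
include hx hJ hdyn

/-- Spectral representation of the state: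
`x t = ∫ exp (i λ t) (i λ - F)⁻¹ G dŵ`. -/
theorem complexify_state (t : ℝ) (i : Fin n) :
    complexify P (x t i) = J (shift t (stateRow hF G i)) := by
  rw [← sub_eq_zero]
  have hcx : ∀ i, Continuous fun t => complexify P (x t i) := fun i =>
    (complexify P).continuous.comp (hx.continuous i)
  have hcJ : ∀ i, Continuous fun t => J (shift t (stateRow hF G i)) := fun i =>
    J.continuous.comp (continuous_shift _)
  -- Both curves solve the state equation with the same noise, so the difference solves `dz = F z
  -- dt`. It is bounded by stationarity of `x` and because shifts are isometric.
  refine eq_zero_of_integral_eq_of_bounded hF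
    (z := fun t i => complexify P (x t i) - J (shift t (stateRow hF G i)))
    (fun i => (hcx i).sub (hcJ i)) (fun s t i => ?_)
    (M := ∑ i, (‖x 0 i‖ + ‖stateRow hF G i‖)) (fun t i => ?_) t i
  · have h1 := hdyn.complexify_sub hx.continuous hJ s t i
    have h2 : J (shift t (stateRow hF G i)) - J (shift s (stateRow hF G i)) =
        ∑ j, (F i j : ℂ) • (∫ τ in s..t, J (shift τ (stateRow hF G j))) +
          ∑ k, (G i k : ℂ) • J (kernelL2 s t k) := by
      rw [← map_sub, shift_stateRow_sub, outputRow, map_add, map_sum, map_sum]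
      simp only [map_smul, integral_isometry_shift]
    rw [map_sub] at h1
    have hc : ∀ j, Continuous fun τ => complexify P (x τ j) - J (shift τ (stateRow hF G j)) :=
      fun j => (hcx j).sub (hcJ j)
    have h3 : ∫ τ in s..t, ∑ j, (F i j : ℂ) •
        (complexify P (x τ j) - J (shift τ (stateRow hF G j))) =
        ∑ j, ((F i j : ℂ) • (∫ τ in s..t, complexify P (x τ j)) -
          (F i j : ℂ) • ∫ τ in s..t, J (shift τ (stateRow hF G j))) := by
      rw [intervalIntegral.integral_finsetSum
        (fun j _ => ((hc j).fun_const_smul (F i j : ℂ)).intervalIntegrable _ _)]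
      refine Finset.sum_congr rfl fun j _ => ?_
      rw [← smul_sub, intervalIntegral.integral_smul, intervalIntegral.integral_sub
        ((hcx j).intervalIntegrable _ _) ((hcJ j).intervalIntegrable _ _)]
    rw [sub_sub_sub_comm, h1, h2, add_sub_add_right_eq_sub, ← Finset.sum_sub_distrib, ← h3]
    rfl
  · refine (norm_sub_le _ _).trans ?_
    rw [norm_complexify, hx.norm_eq, J.norm_map, norm_shift]
    exact Finset.single_le_sum (f := fun i => ‖x 0 i‖ + ‖stateRow hF G i‖)
      (fun _ _ => by positivity) (Finset.mem_univ i)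

/-- Spectral representation of the increments of a linear output. -/
theorem complexify_output {η : L2Curve P (Fin m)} {C : Matrix (Fin m) (Fin n) ℝ}
    {D : Matrix (Fin m) (Fin r) ℝ} (h : HasDifferential η x w C D) (s t : ℝ) (i : Fin m) :
    complexify P (η t i - η s i) = J (outputRow hF G C D s t i) := by
  rw [h.complexify_sub hx.continuous hJ, outputRow, map_add, map_sum, map_sum]
  simp only [map_smul, complexify_state hF hx hJ hdyn, integral_isometry_shift]

end Representation

/-! ### The backward noise as a linear output of the forward representation -/

section Noise

variable {Ω : Type*} [MeasurableSpace Ω] {P : Measure Ω} {m n r : ℕ}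
  {x : L2Curve P (Fin n)} {w w' : L2Curve P (Fin r)}

theorem HasDifferential.mul {p : ℕ} {η : L2Curve P (Fin m)} {C : Matrix (Fin m) (Fin n) ℝ}
    {D : Matrix (Fin m) (Fin r) ℝ} (h : HasDifferential η x w C D)
    (hx : ∀ i, Continuous fun t => x t i) (A : Matrix (Fin p) (Fin m) ℝ) :
    HasDifferential (fun t i => ∑ j, A i j • η t j) x w (A * C) (A * D) := by
  intro s t i
  have hc : ∀ j, Continuous fun τ => ∑ l, C j l • x τ l := fun j =>
    continuous_finsetSum _ fun l _ => (hx l).fun_const_smul _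
  have h1 : ∀ τ, ∑ l, (A * C) i l • x τ l = ∑ j, A i j • ∑ l, C j l • x τ l := by
    intro τ
    simp only [Matrix.mul_apply, Finset.sum_smul, Finset.smul_sum, smul_smul]
    exact Finset.sum_comm
  have h2 : ∑ k, (A * D) i k • (w t k - w s k) =
      ∑ j, A i j • ∑ k, D j k • (w t k - w s k) := by
    simp only [Matrix.mul_apply, Finset.sum_smul, Finset.smul_sum, smul_smul]
    exact Finset.sum_comm
  simp_rw [h1]
  rw [h2, intervalIntegral.integral_finsetSum
    (fun j _ => ((hc j).fun_const_smul (A i j)).intervalIntegrable _ _),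
    ← Finset.sum_sub_distrib, ← Finset.sum_add_distrib]
  refine Finset.sum_congr rfl fun j _ => ?_
  rw [intervalIntegral.integral_smul, ← smul_add, ← h s t j, smul_sub]

theorem HasDifferential.noise_eq {η : L2Curve P (Fin m)} {C C' : Matrix (Fin m) (Fin n) ℝ}
    {D D' : Matrix (Fin m) (Fin r) ℝ} (h : HasDifferential η x w C D)
    (h' : HasDifferential η x w' C' D') (hx : ∀ i, Continuous fun t => x t i)
    (s t : ℝ) (i : Fin m) :
    ∑ k, D' i k • (w' t k - w' s k) =
      (∫ τ in s..t, ∑ j, (C - C') i j • x τ j) + ∑ k, D i k • (w t k - w s k) := by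
  have hc : ∀ C : Matrix (Fin m) (Fin n) ℝ, Continuous fun τ => ∑ l, C i l • x τ l := fun C =>
    continuous_finsetSum _ fun l _ => (hx l).fun_const_smul _
  have h1 := (h s t i).symm.trans (h' s t i)
  simp only [Matrix.sub_apply, sub_smul, Finset.sum_sub_distrib]
  rw [intervalIntegral.integral_sub ((hc C).intervalIntegrable _ _)
    ((hc C').intervalIntegrable _ _), sub_add_eq_add_sub, h1, add_sub_cancel_left]

theorem IsWiener.norm_sq_sum (hw : IsWiener w) (a : Fin r → ℝ) (s t : ℝ) :
    ‖∑ k, a k • (w t k - w s k)‖ ^ 2 = (∑ k, a k ^ 2) * |t - s| := by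
  rw [← real_inner_self_eq_norm_sq, sum_inner, Finset.sum_mul]
  refine Finset.sum_congr rfl fun k _ => ?_
  rw [inner_sum]
  simp only [real_inner_smul_left, real_inner_smul_right, hw.variance]
  simp [sq, mul_assoc]

/-- A Wiener process is not differentiable: a drift cannot cancel a nonzero noise term. -/
theorem IsWiener.eq_zero_of_drift_add_noise (hw : IsWiener w) (hx : IsWideSenseStationary x)
    (c : Fin n → ℝ) (a : Fin r → ℝ)
    (h : ∀ t : ℝ, (∫ τ in (0 : ℝ)..t, ∑ j, c j • x τ j) + ∑ k, a k • (w t k - w 0 k) = 0) :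
    a = 0 := by
  set M := ∑ j, |c j| * ‖x 0 j‖ with hM
  -- The noise has variance `|a|² t` and the drift has norm at most `M t`; comparing them and
  -- dividing by `t` leaves a bound that vanishes as `t → 0`.
  have hle : ∀ t : ℝ, 0 < t → ∑ k, a k ^ 2 ≤ M ^ 2 * t := by
    intro t ht
    have h1 : ‖∑ k, a k • (w t k - w 0 k)‖ ≤ M * t := by
      rw [eq_neg_of_add_eq_zero_right (h t), norm_neg]
      have := intervalIntegral.norm_integral_le_of_norm_le_const (a := 0) (b := t) (C := M)
        (f := fun τ => ∑ j, c j • x τ j) (fun τ _ => by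
          refine (norm_sum_le _ _).trans (Finset.sum_le_sum fun j _ => ?_)
          rw [norm_smul, hx.norm_eq, Real.norm_eq_abs])
      rwa [sub_zero, abs_of_pos ht] at this
    have h2 := hw.norm_sq_sum a 0 t
    rw [sub_zero, abs_of_pos ht] at h2
    have h3 : (∑ k, a k ^ 2) * t ≤ M ^ 2 * t * t := by
      rw [← h2]
      calc _ ≤ (M * t) ^ 2 := by gcongr
        _ = _ := by ring
    exact le_of_mul_le_mul_right h3 ht
  have hlim : Filter.Tendsto (fun t : ℝ => M ^ 2 * t) (nhdsWithin 0 (Set.Ioi 0)) (nhds 0) := by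
    have : Continuous fun t : ℝ => M ^ 2 * t := by fun_prop
    simpa using (this.tendsto 0).mono_left nhdsWithin_le_nhds
  have h0 : ∑ k, a k ^ 2 ≤ 0 :=
    ge_of_tendsto hlim (Filter.eventually_of_mem self_mem_nhdsWithin fun t ht => hle t ht)
  have h1 := (Finset.sum_eq_zero_iff_of_nonneg fun k _ => sq_nonneg (a k)).mp
    (le_antisymm h0 (Finset.sum_nonneg fun k _ => sq_nonneg (a k)))
  funext k
  simpa using h1 k (Finset.mem_univ k)

/-- If every row vector annihilating `B` annihilates `A`, and `A` has full column rank, then `B`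
has a left inverse. -/
theorem exists_left_inverse_of_vecMul {A B : Matrix (Fin n) (Fin r) ℝ}
    (hA : Function.Injective A.mulVec) (h : ∀ a, Matrix.vecMul a B = 0 → Matrix.vecMul a A = 0) :
    ∃ L : Matrix (Fin r) (Fin n) ℝ, L * B = 1 := by
  have hker : LinearMap.ker B.transpose.mulVecLin ≤ LinearMap.ker A.transpose.mulVecLin := by
    intro a ha
    rw [LinearMap.mem_ker, Matrix.mulVecLin_apply, Matrix.mulVec_transpose] at ha ⊢
    exact h a ha
  have h1 := Submodule.finrank_mono hker
  have h2 := LinearMap.finrank_range_add_finrank_ker A.transpose.mulVecLin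
  have h3 := LinearMap.finrank_range_add_finrank_ker B.transpose.mulVecLin
  have h4 : A.rank = r := by
    rw [Matrix.rank, LinearMap.finrank_range_of_inj hA, Module.finrank_fin_fun]
  have h5 : B.rank = r := by
    -- Rank–nullity for the transposes: the smaller kernel belongs to the larger rank, so `rank B ≥
    -- rank A = r`.
    refine le_antisymm (by simpa using B.rank_le_width) ?_
    rw [← Matrix.rank_transpose] at h4 ⊢
    rw [Matrix.rank] at h4 ⊢
    omega
  have hinj : LinearMap.ker B.mulVecLin = ⊥ := by
    have h6 := LinearMap.finrank_range_add_finrank_ker B.mulVecLin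
    rw [Matrix.rank] at h5
    rw [h5, Module.finrank_fin_fun] at h6
    exact Submodule.finrank_eq_zero.mp (by omega)
  obtain ⟨g, hg⟩ := B.mulVecLin.exists_leftInverse_of_injective hinj
  refine ⟨LinearMap.toMatrix' g, ?_⟩
  have := congrArg LinearMap.toMatrix' hg
  rw [LinearMap.toMatrix'_comp, LinearMap.toMatrix'_id] at this
  rwa [← Matrix.toLin'_apply', LinearMap.toMatrix'_toLin'] at this

/-- The backward noise is a linear function of the state and of the forward noise. -/
theorem exists_noise_hasDifferential {F F' : Matrix (Fin n) (Fin n) ℝ}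
    {G G' : Matrix (Fin n) (Fin r) ℝ} (hw : IsWiener w) (hx : IsWideSenseStationary x)
    (h : HasDifferential x x w F G) (h' : HasDifferential x x w' F' G')
    (hG : Function.Injective G.mulVec) :
    ∃ (C : Matrix (Fin r) (Fin n) ℝ) (D : Matrix (Fin r) (Fin r) ℝ),
      HasDifferential w' x w C D := by
  -- For a row with `a G' = 0`, multiplying both state equations by `a` leaves `a (F - F') x dt + a
  -- G dw = 0`, which forces `a G = 0`.
  obtain ⟨L, hL⟩ := exists_left_inverse_of_vecMul hG (B := G') fun a ha => by
    set A : Matrix (Fin 1) (Fin n) ℝ := Matrix.of fun _ => a with hA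
    have h1 : ∀ M : Matrix (Fin n) (Fin r) ℝ, ∀ k, (A * M) 0 k = Matrix.vecMul a M k :=
      fun M k => rfl
    refine hw.eq_zero_of_drift_add_noise hx ((A * F - A * F') 0) _ fun t => ?_
    have h2 := (h.mul hx.continuous A).noise_eq (h'.mul hx.continuous A) hx.continuous 0 t 0
    simp only [h1, ha, Pi.zero_apply, zero_smul, Finset.sum_const_zero] at h2
    exact h2.symm
  -- Multiply `G' dw' = (F - F') x dt + G dw` by `L` and use `L G' = 1`.
  refine ⟨L * F - L * F', L * G, fun s t i => ?_⟩
  have h2 := (h.mul hx.continuous L).noise_eq (h'.mul hx.continuous L) hx.continuous s t i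
  rw [hL] at h2
  rw [← h2]
  simp [Matrix.one_apply]

end Noise

/-! ### The scattering function -/

theorem exists_toEuclideanCLM_bound (r : ℕ) (M : ℝ) :
    ∃ M' : ℝ, ∀ A : Matrix (Fin r) (Fin r) ℂ, (∀ i j, ‖A i j‖ ≤ M) →
      ‖Matrix.toEuclideanCLM (n := Fin r) (𝕜 := ℂ) A‖ ≤ M' := by
  have hcpt : IsCompact {A : Matrix (Fin r) (Fin r) ℂ | ∀ i j, ‖A i j‖ ≤ M} := by
    have := isCompact_univ_pi fun _ : Fin r => isCompact_univ_pi fun _ : Fin r =>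
      isCompact_closedBall (0 : ℂ) M
    have hset : {A : Matrix (Fin r) (Fin r) ℂ | ∀ i j, ‖A i j‖ ≤ M} =
        Set.univ.pi fun _ => Set.univ.pi fun _ => Metric.closedBall 0 M := by
      ext A
      exact ⟨fun h i _ j _ => by simpa using h i j,
        fun h i j => by simpa using h i trivial j trivial⟩
    rw [hset]
    exact this
  have hcont : Continuous fun A : Matrix (Fin r) (Fin r) ℂ =>
      Matrix.toEuclideanCLM (n := Fin r) (𝕜 := ℂ) A :=
    LinearMap.continuous_of_finiteDimensional
      (Matrix.toEuclideanCLM (n := Fin r) (𝕜 := ℂ)).toAlgEquiv.toLinearMap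
  obtain ⟨M', hM'⟩ := hcpt.exists_bound_of_continuousOn hcont.continuousOn
  exact ⟨M', hM'⟩

/-! ### Multiplication by a transfer function on the imaginary axis -/

section Axis

variable {m n r : ℕ} (C : Matrix (Fin m) (Fin n) ℝ) {F : Matrix (Fin n) (Fin n) ℝ}
  (hF : ∀ z ∈ spectrum ℂ (F.map Complex.ofReal), z.re ≠ 0) (G : Matrix (Fin n) (Fin r) ℝ)
  (D : Matrix (Fin m) (Fin r) ℝ)
include hF

theorem continuous_transfer_axis (i : Fin m) (k : Fin r) :
    Continuous fun l : ℝ => transfer C F G D (Complex.I * l) i k := by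
  simp only [transfer_apply]
  exact (continuous_finsetSum _ fun j _ =>
    continuous_const.mul (continuous_stateTransfer_axis hF G j k)).add continuous_const

/-- The transpose appears because `L²` functions act as row vectors, `f ↦ f T`, while operators on
`ℂ^r` act on columns. -/
theorem isBoundedField_transfer (C : Matrix (Fin r) (Fin n) ℝ) (D : Matrix (Fin r) (Fin r) ℝ) :
    IsBoundedField fun l : ℝ => Matrix.toEuclideanCLM (n := Fin r) (𝕜 := ℂ)
      (transfer C F G D (Complex.I * l)).transpose := by
  refine ⟨Continuous.stronglyMeasurable ?_, ?_⟩
  · have hcont : Continuous fun A : Matrix (Fin r) (Fin r) ℂ =>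
        Matrix.toEuclideanCLM (n := Fin r) (𝕜 := ℂ) A :=
      LinearMap.continuous_of_finiteDimensional
        (Matrix.toEuclideanCLM (n := Fin r) (𝕜 := ℂ)).toAlgEquiv.toLinearMap
    refine hcont.comp (continuous_matrix fun i j => ?_)
    exact continuous_transfer_axis C hF G D j i
  · obtain ⟨M, hM⟩ := exists_transfer_bound C F G D (S := {s : ℂ | s.re = 0})
      (isClosed_eq Complex.continuous_re continuous_const) (fun s hs h => hF s h hs)
    obtain ⟨M', hM'⟩ := exists_toEuclideanCLM_bound r M
    exact ⟨M', fun l => hM' _ fun i j => hM _ (by simp) j i⟩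

/-- Multiplication of row vector functions of frequency by a transfer function. -/
noncomputable def transferMul (C : Matrix (Fin r) (Fin n) ℝ) (D : Matrix (Fin r) (Fin r) ℝ) :
    FreqL2 r →L[ℂ] FreqL2 r :=
  fieldMul (isBoundedField_transfer hF G C D)

theorem transferMul_ae (C : Matrix (Fin r) (Fin n) ℝ) (D : Matrix (Fin r) (Fin r) ℝ)
    (f : FreqL2 r) : ∀ᵐ l ∂freqMeasure, ∀ k,
      transferMul hF G C D f l k = ∑ j, f l j * transfer C F G D (Complex.I * l) j k := by
  filter_upwards [fieldMul_ae (isBoundedField_transfer hF G C D) f] with l hl k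
  rw [transferMul, hl, Matrix.ofLp_toEuclideanCLM, Matrix.mulVec_transpose]
  rfl

theorem transferMul_kernelL2 (C : Matrix (Fin r) (Fin n) ℝ) (D : Matrix (Fin r) (Fin r) ℝ)
    (s t : ℝ) (k : Fin r) :
    transferMul hF G C D (kernelL2 s t k) = outputRow hF G C D s t k := by
  refine Lp.ext ?_
  filter_upwards [transferMul_ae hF G C D (kernelL2 s t k), kernelL2_ae s t k,
    outputRow_ae hF G C D s t k] with l h1 h2 h3
  ext i
  rw [h1, h2, h3]
  simp [PiLp.single_apply]

/-- A transfer function whose multiplication operator is isometric is unitary on the imaginary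
axis. -/
theorem transfer_mem_unitaryGroup (C : Matrix (Fin r) (Fin n) ℝ) (D : Matrix (Fin r) (Fin r) ℝ)
    (hnorm : ∀ f, ‖transferMul hF G C D f‖ = ‖f‖) (l : ℝ) :
    transfer C F G D (Complex.I * l) ∈ Matrix.unitaryGroup (Fin r) ℂ := by
  set K := fun l : ℝ => transfer C F G D (Complex.I * l) with hK
  set T : FreqL2 r →ₗᵢ[ℂ] FreqL2 r := ⟨(transferMul hF G C D).toLinearMap, hnorm⟩ with hT
  have hTm : ∀ f, T f = transferMul hF G C D f := fun _ => rfl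
  have hae : ∀ j k, ∀ᵐ l : ℝ, ∑ i, K l k i * star (K l j i) = if j = k then 1 else 0 := by
    intro j k
    set f : FreqL2 r := kernelL2 0 1 j
    set g : FreqL2 r := kernelL2 0 1 k
    -- An isometry that commutes with multiplication by indicators preserves the inner product
    -- integrated over every measurable set, hence pointwise almost everywhere.
    have hset : ∀ A, MeasurableSet A →
        ∫ l in A, inner ℂ (T f l) (T g l) ∂freqMeasure =
          ∫ l in A, inner ℂ (f l) (g l) ∂freqMeasure := by
      intro A hA
      set m : ℝ → ℂ := A.indicator fun _ => 1
      have hm : ∀ l, ‖m l‖ ≤ 1 := fun l => by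
        by_cases h : l ∈ A <;> simp [m, h]
      have hB := isBoundedField_smul_id (r := r)
        ((measurable_const.indicator hA : Measurable m)) hm
      have hmul : ∀ q : FreqL2 r, ∀ u : FreqL2 r,
          inner ℂ u (fieldMul hB q) = ∫ l in A, inner ℂ (u l) (q l) ∂freqMeasure := by
        intro q u
        rw [L2.inner_def, ← integral_indicator hA]
        refine integral_congr_ae ?_
        filter_upwards [fieldMul_ae hB q] with l hl
        rw [hl]
        by_cases h : l ∈ A <;> simp [h]
      have hTB : T (fieldMul hB g) = fieldMul hB (T g) := by
        refine Lp.ext ?_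
        filter_upwards [transferMul_ae hF G C D (fieldMul hB g), transferMul_ae hF G C D g,
          fieldMul_ae hB g, fieldMul_ae hB (T g)] with l h1 h2 h3 h4
        ext i
        rw [hTm, h1, h4, h3, hTm]
        simp only [_root_.smul_apply, ContinuousLinearMap.id_apply,
          PiLp.smul_apply, smul_eq_mul, h2, Finset.mul_sum, mul_assoc]
      rw [← hmul, ← hmul, ← hTB, T.inner_map_map]
    have h1 := (L2.integrable_inner (𝕜 := ℂ) (T f) (T g)).ae_eq_of_forall_setIntegral_eq _ _
      (L2.integrable_inner (𝕜 := ℂ) f g) (fun A hA _ => hset A hA)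
    have h2 := ae_freqMeasure_iff.mp (h1.and ((transferMul_ae hF G C D f).and
      ((transferMul_ae hF G C D g).and ((kernelL2_ae 0 1 j).and (kernelL2_ae 0 1 k)))))
    filter_upwards [h2, incrementKernel_ne_zero_ae] with l ⟨h1, h2, h3, h4, h5⟩ h6
    set κ := incrementKernel 0 1 l
    have hf : ∀ i, T f l i = κ * K l j i := by
      intro i
      rw [hTm, h2, h4]
      simp [PiLp.single_apply, K]
    have hg : ∀ i, T g l i = κ * K l k i := by
      intro i
      rw [hTm, h3, h5]
      simp [PiLp.single_apply, K]
    rw [h4, h5, PiLp.inner_apply, EuclideanSpace.inner_single_left] at h1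
    have hne : κ * star κ ≠ 0 := mul_ne_zero h6 (star_ne_zero.mpr h6)
    refine mul_left_cancel₀ hne ?_
    have h7 : κ * star κ * ∑ i, K l k i * star (K l j i) =
        ∑ i, inner ℂ (T f l i) (T g l i) := by
      rw [Finset.mul_sum]
      refine Finset.sum_congr rfl fun i _ => ?_
      rw [hf, hg, RCLike.inner_apply, starRingEnd_apply, star_mul']
      ring
    rw [h7, h1, PiLp.single_apply, starRingEnd_apply]
    split_ifs
    · ring
    · ring
  rw [Matrix.mem_unitaryGroup_iff]
  ext k j
  -- Continuity upgrades the almost-everywhere identity to every frequency.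
  have hcont : Continuous fun l : ℝ => ∑ i, K l k i * star (K l j i) :=
    continuous_finsetSum _ fun i _ => (continuous_transfer_axis C hF G D k i).mul
      (continuous_transfer_axis C hF G D j i).star
  have := congrFun ((hcont.ae_eq_iff_eq (μ := volume) continuous_const).mp (hae j k)) l
  rw [Matrix.mul_apply, Matrix.one_apply]
  simp only [Matrix.star_apply]
  rw [this]
  simp only [eq_comm]

end Axis

theorem sum_norm_sq_eq_norm_toLp {r : ℕ} (y : Fin r → ℂ) :
    ∑ k, ‖y k‖ ^ 2 = ‖(WithLp.toLp 2 y : EuclideanSpace ℂ (Fin r))‖ ^ 2 := by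
  rw [EuclideanSpace.norm_sq_eq]

/-- The maximum principle: a stable transfer function that is unitary on the imaginary axis is
contractive in the right half plane. -/
theorem transfer_contractive {n r : ℕ} {C : Matrix (Fin r) (Fin n) ℝ}
    {F : Matrix (Fin n) (Fin n) ℝ} {G : Matrix (Fin n) (Fin r) ℝ} {D : Matrix (Fin r) (Fin r) ℝ}
    (hF : ∀ z ∈ spectrum ℂ (F.map Complex.ofReal), z.re < 0)
    (hunit : ∀ l : ℝ, transfer C F G D (Complex.I * l) ∈ Matrix.unitaryGroup (Fin r) ℂ)
    {s : ℂ} (hs : 0 ≤ s.re) (v : Fin r → ℂ) :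
    ∑ k, ‖(transfer C F G D s).mulVec v k‖ ^ 2 ≤ ∑ k, ‖v k‖ ^ 2 := by
  set V : EuclideanSpace ℂ (Fin r) := WithLp.toLp 2 v with hV
  set f : ℂ → EuclideanSpace ℂ (Fin r) := fun s =>
    Matrix.toEuclideanCLM (n := Fin r) (𝕜 := ℂ) (transfer C F G D s) V with hf
  have hfs : ∀ s, f s = WithLp.toLp 2 ((transfer C F G D s).mulVec v) := fun _ => rfl
  have hreg : ∀ s : ℂ, 0 ≤ s.re → s ∉ spectrum ℂ (F.map Complex.ofReal) := fun s hs h =>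
    absurd (hF s h) (not_lt.mpr hs)
  obtain ⟨M, hM⟩ := exists_transfer_bound C F G D (S := {s : ℂ | 0 ≤ s.re})
    (isClosed_le continuous_const Complex.continuous_re) hreg
  obtain ⟨M', hM'⟩ := exists_toEuclideanCLM_bound r M
  have hbound : ∀ s : ℂ, 0 ≤ s.re → ‖f s‖ ≤ M' * ‖V‖ := fun s hs =>
    ContinuousLinearMap.le_of_opNorm_le _ (hM' _ (hM s hs)) _
  have hdiff : DiffContOnCl ℂ f {z | 0 < z.re} := by
    refine DifferentiableOn.diffContOnCl fun s hs => ?_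
    rw [Complex.closure_setOfPred_lt_re] at hs
    refine DifferentiableAt.differentiableWithinAt ?_
    rw [differentiableAt_piLp]
    intro i
    simp only [hfs, Matrix.mulVec, dotProduct]
    exact DifferentiableAt.fun_sum fun j _ =>
      (differentiableAt_transfer C F G D (hreg s hs) i j).mul_const _
  have key : ‖f s‖ ≤ ‖V‖ := by
    -- With both constants zero the growth condition is plain boundedness, which the decay of the
    -- resolvent provides.
    refine PhragmenLindelof.right_half_plane_of_bounded_on_real hdiff
      ⟨0, by norm_num, 0, ?_⟩ ?_ (fun l => ?_) hs
    · simp only [zero_mul, Real.exp_zero]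
      refine Asymptotics.IsBigO.of_bound (M' * ‖V‖) ?_
      rw [Filter.eventually_inf_principal]
      refine Filter.Eventually.of_forall fun z hz => ?_
      simpa using hbound z (le_of_lt hz)
    · refine ⟨M' * ‖V‖, ?_⟩
      rw [Filter.eventually_map]
      filter_upwards [Filter.eventually_ge_atTop 0] with a ha
      exact hbound a (by simpa using ha)
    · rw [mul_comm]
      have hmem : Matrix.toEuclideanCLM (n := Fin r) (𝕜 := ℂ) (transfer C F G D (Complex.I * l)) ∈
          unitary (EuclideanSpace ℂ (Fin r) →L[ℂ] EuclideanSpace ℂ (Fin r)) :=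
        Unitary.map_mem (Matrix.toEuclideanCLM (n := Fin r) (𝕜 := ℂ)) (hunit l)
      exact (ContinuousLinearMap.norm_map_of_mem_unitary hmem V).le
  rw [sum_norm_sq_eq_norm_toLp, sum_norm_sq_eq_norm_toLp, ← hfs]
  gcongr

/-! ### The relation between the two spectral isometries -/

section Scattering

variable {Ω : Type*} [MeasurableSpace Ω] {P : Measure Ω} {n r : ℕ}
  {x : L2Curve P (Fin n)} {w w' : L2Curve P (Fin r)}
  {F F' : Matrix (Fin n) (Fin n) ℝ} {G G' : Matrix (Fin n) (Fin r) ℝ}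
  {J J' : FreqL2 r →ₗᵢ[ℂ] Lp ℂ 2 P} {L : Matrix (Fin r) (Fin n) ℝ} {E : Matrix (Fin r) (Fin r) ℝ}

/-- If `dw' = L x dt + E dw` then `dŵ' = K dŵ` with `K` the transfer function from `w` to `w'`. -/
theorem fourierTransform_noise (hF : ∀ z ∈ spectrum ℂ (F.map Complex.ofReal), z.re ≠ 0)
    (hx : IsWideSenseStationary x) (hJ : IsFourierTransform w J) (hJ' : IsFourierTransform w' J')
    (hdyn : HasDifferential x x w F G) (hw' : HasDifferential w' x w L E) (f : FreqL2 r) :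
    J' f = J (transferMul hF G L E f) := by
  have h : J'.toContinuousLinearMap =
      J.toContinuousLinearMap.comp (transferMul hF G L E) := by
    refine freqL2_clm_ext fun s t k => ?_
    have h1 := isFourierTransform_iff.mp hJ' s t k
    rw [complexify_output hF hx hJ hdyn hw'] at h1
    rw [ContinuousLinearMap.comp_apply, transferMul_kernelL2]
    exact h1
  exact congrArg (fun T : FreqL2 r →L[ℂ] Lp ℂ 2 P => T f) h

/-- The two isometries are determined by the noises and `J` is injective, so one nowhere-vanishing
(up to a null set) kernel per row reads off the entries of the matrix. -/
theorem IsScatteringFunction.ae_eq {K K' : ℝ → Matrix (Fin r) (Fin r) ℂ}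
    (h : IsScatteringFunction w w' K) (h' : IsScatteringFunction w w' K') :
    ∀ᵐ l : ℝ, K' l = K l := by
  obtain ⟨J, J', hJ, hJ', hK⟩ := h
  obtain ⟨J₁, J₁', hJ₁, hJ₁', hK'⟩ := h'
  obtain rfl := hJ.unique hJ₁
  obtain rfl := hJ'.unique hJ₁'
  have hrow : ∀ j, ∀ᵐ l : ℝ, ∀ k, K' l j k = K l j k := by
    intro j
    obtain ⟨g, hg, hJg⟩ := hK (kernelL2 0 1 j)
    obtain ⟨g', hg', hJg'⟩ := hK' (kernelL2 0 1 j)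
    obtain rfl : g = g' := J.injective (hJg.symm.trans hJg')
    filter_upwards [ae_freqMeasure_iff.mp (hg.and (hg'.and (kernelL2_ae 0 1 j))),
      incrementKernel_ne_zero_ae] with l ⟨h1, h2, h3⟩ h4 k
    have h5 := (h2 k).symm.trans (h1 k)
    rw [h3] at h5
    simp only [PiLp.single_apply, ite_mul, zero_mul, Finset.sum_ite_eq', Finset.mem_univ,
      if_true] at h5
    exact mul_left_cancel₀ h4 h5
  filter_upwards [ae_all_iff.mpr hrow] with l hl
  ext j k
  exact hl j k

/-- The transfer functions of a common output of the two representations are related by the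
transfer function between the noises, on the imaginary axis. -/
theorem transfer_ae_eq_mul (hF : ∀ z ∈ spectrum ℂ (F.map Complex.ofReal), z.re ≠ 0)
    (hF' : ∀ z ∈ spectrum ℂ (F'.map Complex.ofReal), z.re ≠ 0)
    (hx : IsWideSenseStationary x) (hJ : IsFourierTransform w J) (hJ' : IsFourierTransform w' J')
    (hdyn : HasDifferential x x w F G) (hdyn' : HasDifferential x x w' F' G')
    (hw' : HasDifferential w' x w L E) {η : L2Curve P (Fin r)}
    {C C' : Matrix (Fin r) (Fin n) ℝ} {D D' : Matrix (Fin r) (Fin r) ℝ}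
    (h : HasDifferential η x w C D) (h' : HasDifferential η x w' C' D') :
    ∀ᵐ l : ℝ, transfer C F G D (Complex.I * l) =
      transfer C' F' G' D' (Complex.I * l) * transfer L F G E (Complex.I * l) := by
  have hrow : ∀ i, ∀ᵐ l : ℝ, ∀ k, transfer C F G D (Complex.I * l) i k =
      (transfer C' F' G' D' (Complex.I * l) * transfer L F G E (Complex.I * l)) i k := by
    intro i
    -- One increment of `η` is computed in both representations; rewriting `J'` through `J` and
    -- using injectivity compares the two rows.
    have h1 := complexify_output hF hx hJ hdyn h 0 1 i
    rw [complexify_output hF' hx hJ' hdyn' h', fourierTransform_noise hF hx hJ hJ' hdyn hw'] at h1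
    have h2 := J.injective h1
    have h3 := transferMul_ae hF G L E (outputRow hF' G' C' D' 0 1 i)
    rw [h2] at h3
    filter_upwards [ae_freqMeasure_iff.mp (h3.and ((outputRow_ae hF G C D 0 1 i).and
      (outputRow_ae hF' G' C' D' 0 1 i))), incrementKernel_ne_zero_ae] with l ⟨h4, h5, h6⟩ h7 k
    refine mul_left_cancel₀ h7 ?_
    rw [← h5, h4, Matrix.mul_apply, Finset.mul_sum]
    exact Finset.sum_congr rfl fun j _ => by rw [h6, mul_assoc]
  filter_upwards [ae_all_iff.mpr hrow] with l hl
  ext i k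
  exact hl i k

end Scattering

/-! ### Assembly of the main theorem -/

theorem mainTheorem2 {Ω : Type*} [MeasurableSpace Ω] (P : Measure Ω) [IsProbabilityMeasure P]
    (n r : ℕ)
    (x : L2Curve P (Fin n)) (w w' : L2Curve P (Fin r))
    (F F' : Matrix (Fin n) (Fin n) ℝ) (G G' : Matrix (Fin n) (Fin r) ℝ)
    (hforward : IsForwardRep x w F G) (hbackward : IsBackwardRep x w' F' G')
    (hG : Function.Injective G.mulVec) :
    ∃ K : ℂ → Matrix (Fin r) (Fin r) ℂ,
      -- `K` is inner and is the (unique) scattering function of the pair `(w, w')`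
      IsRationalInner K ∧
      IsScatteringFunction w w' (fun l : ℝ => K (Complex.I * l)) ∧
      (∀ K' : ℝ → Matrix (Fin r) (Fin r) ℂ, IsScatteringFunction w w' K' →
        ∀ᵐ l : ℝ, K' l = K (Complex.I * l)) ∧
      -- whatever the output functional, the transfer functions satisfy `T'⁻¹ T = K`
      ∀ (η : L2Curve P (Fin r))
        (C C' : Matrix (Fin r) (Fin n) ℝ) (D D' : Matrix (Fin r) (Fin r) ℝ),
        HasDifferential η x w C D → HasDifferential η x w' C' D' →
        TransferInvertible C F G D →
        TransferInvertible C' F' G' D' ∧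
        {l : ℝ | (transfer C' F' G' D' (Complex.I * l)).det = 0}.Finite ∧
        (∀ l : ℝ, (transfer C' F' G' D' (Complex.I * l)).det ≠ 0 →
          (transfer C' F' G' D' (Complex.I * l))⁻¹ * transfer C F G D (Complex.I * l)
            = K (Complex.I * l)) ∧
        ∀ s : ℂ, s ∉ spectrum ℂ (F.map Complex.ofReal) →
          s ∉ spectrum ℂ (F'.map Complex.ofReal) →
          (transfer C' F' G' D' s).det ≠ 0 →
          (transfer C' F' G' D' s)⁻¹ * transfer C F G D s = K s := by
  have hF : ∀ z ∈ spectrum ℂ (F.map Complex.ofReal), z.re ≠ 0 := fun z hz =>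
    (hforward.stable z hz).ne
  have hF' : ∀ z ∈ spectrum ℂ (F'.map Complex.ofReal), z.re ≠ 0 := fun z hz =>
    (hbackward.antistable z hz).ne'
  have hx := hforward.stationary
  obtain ⟨L, E, hw'⟩ := exists_noise_hasDifferential hforward.wiener hx hforward.dynamics
    hbackward.dynamics hG
  obtain ⟨J, hJ⟩ := hforward.wiener.exists_isFourierTransform
  obtain ⟨J', hJ'⟩ := hbackward.wiener.exists_isFourierTransform
  have hJJ' := fourierTransform_noise hF hx hJ hJ' hforward.dynamics hw'
  have hunit : ∀ l : ℝ, transfer L F G E (Complex.I * l) ∈ Matrix.unitaryGroup (Fin r) ℂ := by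
    -- `J'` is `J` composed with multiplication by `K`, and both are isometric.
    refine transfer_mem_unitaryGroup hF G L E fun f => ?_
    rw [← J.norm_map, ← hJJ', J'.norm_map]
  have hscat : IsScatteringFunction w w' fun l : ℝ => transfer L F G E (Complex.I * l) :=
    ⟨J, J', hJ, hJ', fun f => ⟨transferMul hF G L E f, transferMul_ae hF G L E f, hJJ' f⟩⟩
  -- `K` is the transfer function of `w'` as a forward output, with denominator the characteristic
  -- polynomial of the stable matrix `F`; it is fixed before any `η` appears.
  refine ⟨transfer L F G E, ⟨⟨transferNum L F G E, F.charpoly, fun s hs => ?_, fun s hs i j => ?_⟩,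
    fun s hs v => transfer_contractive hforward.stable hunit hs.le v, hunit⟩, hscat,
    fun K' hK' => hscat.ae_eq hK', fun η C C' D D' h h' hinv => ?_⟩
  · rw [aeval_charpoly_ne_zero_iff]
    exact fun hmem => absurd (hforward.stable s hmem) (not_lt.mpr hs)
  · exact transfer_apply_eq_div L F G E ((aeval_charpoly_ne_zero_iff F).mp hs) i j
  · have hreg := I_mul_ofReal_notMem_spectrum hF
    have hreg' := I_mul_ofReal_notMem_spectrum hF'
    have hae := transfer_ae_eq_mul hF hF' hx hJ hJ' hforward.dynamics hbackward.dynamics hw' h h'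
    have hall : ∀ s : ℂ, s ∉ spectrum ℂ (F.map Complex.ofReal) →
        s ∉ spectrum ℂ (F'.map Complex.ofReal) → (transfer C' F' G' D' s).det ≠ 0 →
        (transfer C' F' G' D' s)⁻¹ * transfer C F G D s = transfer L F G E s := by
      intro s hs hs' hdet
      rw [transfer_eq_mul_of_ae hreg hreg' hae hs hs',
        Matrix.nonsing_inv_mul_cancel_left _ _ (isUnit_iff_ne_zero.mpr hdet)]
    exact ⟨transferInvertible_of_ae hreg hreg' hae hinv,
      finite_det_transfer_eq_zero hreg hreg' hae hinv,
      fun l hl => hall _ (hreg l) (hreg' l) hl, hall⟩
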